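/- Conventions. A length function on a group $K$ is a map $l:K\to\mathbb N$ with $l(e)=0$, $l(x^{-1})=l(x)$ and $l(xy)\le l(x)+l(y)$. For $\varphi\in\mathbb C[K]$ let $\|\varphi\|$ be the operator norm of $\varphi$ acting on $\ell^2(K)$ by the left regular representation and $\|\varphi\|_2=(\sum_x|\varphi(x)|^2)^{1/2}$. For $f:\mathbb N\to\mathbb R$, the pair $(K,l)$ has $f$-decay if $\|\varphi\|\le f(n)\|\varphi\|_2$ for all $n\in\mathbb N$ and all $\varphi\in\mathbb C[K]$ supported on $\{x: l(x)\le n\}$. A function $f:\mathbb N\to\mathbb R_{\ge0}$ is subexponential if $f(n)^{1/n}\to1$. The pair $(K,l)$ has RD (resp. SD) if it has $f$-decay for some polynomial (resp. subexponential) $f$; $K$ has RD (resp. SD) if $(K,l)$ does for some length function $l$. Two length functions $l_1,l_2$ on $K$ are $g$-distorted if $l_1(x)\le g(l_2(x))$ and $l_2(x)\le g(l_1(x))$ for all $x\in K$; they are polynomially, subexponentially or linearly distorted if $g$ can be chosen polynomial, subexponential, or of the form $g(n)=Cn+D$. For $f:\mathbb N\to\mathbb R$ put $\tilde f(x)=(2x+1)^{7/2}f(2x)$.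 Theorem. Let $(G,L_G)$ and $(H,L_H)$ be groups with length functions and a common subgroup $A$. For $k\in G*_AH$ let $$L^U(k)=\min\Big\{\sum_i L_i(k_i)\ :\ \prod_i k_i=k,\ k_i\in G\cup H\Big\},$$ where $L_i=L_G$ if $k_i\in G\setminus A$, $L_i=L_H$ if $k_i\in H\setminus A$, and $L_i$ may be chosen to be either $L_G$ or $L_H$ if $k_i\in A$. Then $L^U$ is a length function on $G*_AH$. Moreover: (0) Suppose that $L_G\ge1$ on $G\setminus A$ and $L_H\ge1$ on $H\setminus A$. Let $f:\mathbb N\to\mathbb R$ and let $g:\mathbb N\to\mathbb N$ be non-decreasing. If $(G,L_G)$ and $(H,L_H)$ have $f$-decay and the pairs $(L^U|_G,L_G)$ on $G$ and $(L^U|_H,L_H)$ on $H$ are $g$-distorted, then $(G*_AH,L^U)$ has $\widetilde{f\circ g}$-decay, where $\widetilde{f\circ g}(x)=(2x+1)^{7/2}f(g(2x))$. If in addition $g(n)\ge n$ for all $n$, then $G*_AH$ has $\tilde f\circ g$-decay with respect to the length function $2L^U$, where $(\tilde f\circ g)(x)=(2g(x)+1)^{7/2}f(2g(x))$; and if moreover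 $g(2n)\le 2g(n)$ for all $n$, then $(G*_AH,L^U)$ has $\tilde f\circ g$-decay. (1) If $(G,L_G)$ and $(H,L_H)$ have RD and the pairs $(L^U|_G,L_G)$ and $(L^U|_H,L_H)$ are polynomially distorted, then $G*_AH$ has RD. (2) If $(G,L_G)$ and $(H,L_H)$ have RD and the pairs $(L^U|_G,L_G)$ and $(L^U|_H,L_H)$ are subexponentially distorted, then $G*_AH$ has SD. (3) If $(G,L_G)$ and $(H,L_H)$ have SD and the pairs $(L^U|_G,L_G)$ and $(L^U|_H,L_H)$ are linearly distorted, then $G*_AH$ has SD. In (1)-(3), if $L_G\ge1$ on $G\setminus A$ and $L_H\ge1$ on $H\setminus A$, then $(G*_AH,L^U)$ itself has RD (resp. SD). -/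

import Mathlib

universe u v

noncomputable section

namespace GroupDecay

/-! ### Length functions -/

/-- A length function on a group, with values in the natural numbers. -/
structure IsLength {G : Type*} [Group G] (l : G → ℕ) : Prop where
  map_one : l 1 = 0
  map_inv : ∀ x, l x⁻¹ = l x
  map_mul_le : ∀ x y, l (x * y) ≤ l x + l y

/-! ### The left regular representation and decay -/

/-- The Hilbert space `ℓ²(G)`. -/
abbrev L2 (G : Type*) : Type _ := lp (fun _ : G => ℂ) 2

theorem memlp_translate {G : Type*} [Group G] (g : G) (ξ : L2 G) :
    Memℓp (fun x : G => (ξ : G → ℂ) (g⁻¹ * x)) 2 := by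
  have h2 : 0 < (2 : ENNReal).toReal := by norm_num
  refine memℓp_gen ?_
  exact (Equiv.mulLeft g⁻¹).summable_iff.mpr ((memℓp_gen_iff h2).1 (lp.memℓp ξ))

/-- The unitary `λ(g)` of the left regular representation: `(λ(g) ξ)(x) = ξ(g⁻¹ x)`. -/
def translate {G : Type*} [Group G] (g : G) : L2 G →ₗᵢ[ℂ] L2 G where
  toFun ξ := ⟨fun x => (ξ : G → ℂ) (g⁻¹ * x), memlp_translate g ξ⟩
  map_add' _ _ := rfl
  map_smul' _ _ := rfl
  norm_map' ξ := by
    have h2 : 0 < (2 : ENNReal).toReal := by norm_num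
    rw [lp.norm_eq_tsum_rpow h2, lp.norm_eq_tsum_rpow h2]
    congr 1
    exact (Equiv.mulLeft g⁻¹).tsum_eq (fun x => ‖(ξ : G → ℂ) x‖ ^ (2 : ENNReal).toReal)

/-- The operator on `ℓ²(G)` by which an element of `ℂ[G]` acts in the left regular
representation, `λ(φ) = ∑ φ(g) λ(g)`. -/
def regularRep {G : Type*} [Group G] (φ : MonoidAlgebra ℂ G) : L2 G →L[ℂ] L2 G :=
  ∑ g ∈ φ.coeff.support, φ.coeff g • (translate g).toContinuousLinearMap

/-- The norm `‖φ‖₂ = (∑ |φ(g)|²)^{1/2}` of an element of `ℂ[G]`. -/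
def twoNorm {G : Type*} (φ : MonoidAlgebra ℂ G) : ℝ :=
  Real.sqrt (∑ g ∈ φ.coeff.support, ‖φ.coeff g‖ ^ 2)

/-- `(G, l)` has `f`-decay: `‖λ(φ)‖ ≤ f(n) ‖φ‖₂` for every `φ ∈ ℂ[G]` supported on the closed
`l`-ball of radius `n` around the identity. -/
def HasDecay {G : Type*} [Group G] (l : G → ℕ) (f : ℕ → ℝ) : Prop :=
  ∀ (n : ℕ) (φ : MonoidAlgebra ℂ G), (∀ g ∈ φ.coeff.support, l g ≤ n) →
    ‖regularRep φ‖ ≤ f n * twoNorm φ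

/-- A function `f : ℕ → ℝ≥0` is subexponential if `f(n)^{1/n} → 1`. -/
def Subexponential (f : ℕ → ℝ) : Prop :=
  (∀ n, 0 ≤ f n) ∧
    Filter.Tendsto (fun n : ℕ => f n ^ (1 / (n : ℝ))) Filter.atTop (nhds 1)

/-- Rapid decay with respect to a given length function. -/
def HasRDWith {G : Type*} [Group G] (l : G → ℕ) : Prop :=
  ∃ P : Polynomial ℝ, HasDecay l (fun n => P.eval (n : ℝ))

/-- Subexponential decay with respect to a given length function. -/
def HasSDWith {G : Type*} [Group G] (l : G → ℕ) : Prop :=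
  ∃ f : ℕ → ℝ, Subexponential f ∧ HasDecay l f

/-- Property RD of a group. -/
def HasRD (G : Type*) [Group G] : Prop := ∃ l : G → ℕ, IsLength l ∧ HasRDWith l

/-- Property SD of a group. -/
def HasSD (G : Type*) [Group G] : Prop := ∃ l : G → ℕ, IsLength l ∧ HasSDWith l

/-! ### Distortion -/

/-- The pair `(l₁, l₂)` is `g`-distorted. -/
def Distorted {G : Type*} (g : ℕ → ℝ) (l₁ l₂ : G → ℕ) : Prop :=
  ∀ x, (l₁ x : ℝ) ≤ g (l₂ x) ∧ (l₂ x : ℝ) ≤ g (l₁ x)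

def PolynomiallyDistorted {G : Type*} (l₁ l₂ : G → ℕ) : Prop :=
  ∃ P : Polynomial ℝ, Distorted (fun n => P.eval (n : ℝ)) l₁ l₂

def SubexponentiallyDistorted {G : Type*} (l₁ l₂ : G → ℕ) : Prop :=
  ∃ g : ℕ → ℝ, Subexponential g ∧ Distorted g l₁ l₂

def LinearlyDistorted {G : Type*} (l₁ l₂ : G → ℕ) : Prop :=
  ∃ C D : ℝ, Distorted (fun n => C * (n : ℝ) + D) l₁ l₂

/-- The operation `f ↦ f̃`, where `f̃(x) = (2x+1)^{7/2} f(2x)`. -/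
def tilde (f : ℕ → ℝ) : ℕ → ℝ :=
  fun x => (2 * (x : ℝ) + 1) ^ (7 / 2 : ℝ) * f (2 * x)

/-! ### Amalgamated free products of two groups -/

/-- The two-element family consisting of `G` and `H`. -/
def Pair (G H : Type u) : Bool → Type u
  | false => G
  | true => H

instance instGroupPair (G H : Type u) [Group G] [Group H] : ∀ b, Group (Pair G H b)
  | false => inferInstanceAs (Group G)
  | true => inferInstanceAs (Group H)

section Amalgam

variable {G H : Type u} {A : Type v} [Group G] [Group H] [Group A]

/-- The two inclusions of the common subgroup `A`. -/
def pairHom (i : A →* G) (j : A →* H) : ∀ b, A →* Pair G H b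
  | false => i
  | true => j

/-- The amalgamated free product `G *_A H`. -/
abbrev Amalgam (i : A →* G) (j : A →* H) : Type _ := Monoid.PushoutI (pairHom i j)

/-- The canonical map `G → G *_A H`. -/
def Amalgam.inl (i : A →* G) (j : A →* H) : G →* Amalgam i j :=
  Monoid.PushoutI.of (φ := pairHom i j) false

/-- The canonical map `H → G *_A H`. -/
def Amalgam.inr (i : A →* G) (j : A →* H) : H →* Amalgam i j :=
  Monoid.PushoutI.of (φ := pairHom i j) true

/-- The universal length `L^U` on `G *_A H`: the minimum of `∑ Lᵢ(kᵢ)` over all factorizations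
`k = ∏ kᵢ` with `kᵢ ∈ G ∪ H`. A factorization is a list of letters, each marked as an element of
`G` (and measured by `LG`) or of `H` (and measured by `LH`), so that a letter from `A` may be
measured by either of the two lengths. -/
def universalLength (i : A →* G) (j : A →* H) (LG : G → ℕ) (LH : H → ℕ) (k : Amalgam i j) : ℕ :=
  sInf {n | ∃ w : List (G ⊕ H),
    (w.map (Sum.elim (Amalgam.inl i j) (Amalgam.inr i j))).prod = k ∧
    (w.map (Sum.elim LG LH)).sum = n}

/-- The restriction `L^U|_G`. -/
def universalLengthLeft (i : A →* G) (j : A →* H) (LG : G → ℕ) (LH : H → ℕ) (x : G) : ℕ :=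
  universalLength i j LG LH (Amalgam.inl i j x)

/-- The restriction `L^U|_H`. -/
def universalLengthRight (i : A →* G) (j : A →* H) (LG : G → ℕ) (LH : H → ℕ) (y : H) : ℕ :=
  universalLength i j LG LH (Amalgam.inr i j y)

/-- Every element of `G` outside `A` and every element of `H` outside `A` has length at least
`1`. -/
def PositiveOffAmalgam (i : A →* G) (j : A →* H) (LG : G → ℕ) (LH : H → ℕ) : Prop :=
  (∀ x : G, x ∉ i.range → 1 ≤ LG x) ∧ (∀ y : H, y ∉ j.range → 1 ≤ LH y)

end Amalgam

end GroupDecay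

end

open GroupDecay

/-!
`f`-decay on a set `B` is an estimate `∑ φ(a) ψ(b) χ(ab) ≤ C ‖φ‖₂ ‖ψ‖₂ ‖χ‖₂` for non-negative
functions with `φ` supported in `B`. `G *_A H` acts on its Bass–Serre tree, and the ball `{L^U ≤ n}`
moves the base vertex by at most `2n`. For `a` in that ball and any `b`, the three geodesics
joining the base vertex, its image under `a` and its image under `ab` have a common vertex. Cutting
`a`, `b` and `ab` at that vertex turns the trilinear sum over the group into trilinear sums over
vertex stabilizers, which are conjugates of `G` and `H`. Choosing coset representatives of minimal
`L^U`-length puts the middle factor of `a` into the ball of radius `2n` of the stabilizer, where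
decay of the factor applies. The number of positions of the cutting vertex costs the factor
`(2n + 1)²`.
-/

open scoped ENNReal NNReal

namespace GroupDecay

section SquareSum

variable {X Y Z : Type*}

/-- The `ℓ²` norm `(∑ φ(x)²)^{1/2}` of a function with values in `[0, ∞]`; it is `∞` when the sum
diverges. -/
noncomputable def l2Norm (φ : X → ℝ≥0∞) : ℝ≥0∞ := (∑' x, φ x ^ 2) ^ (1 / 2 : ℝ)

theorem l2Norm_sq (φ : X → ℝ≥0∞) : l2Norm φ ^ 2 = ∑' x, φ x ^ 2 := by
  rw [l2Norm, ← ENNReal.rpow_natCast, ← ENNReal.rpow_mul]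
  norm_num

theorem l2Norm_le_iff {φ : X → ℝ≥0∞} {c : ℝ≥0∞} : l2Norm φ ≤ c ↔ ∑' x, φ x ^ 2 ≤ c ^ 2 := by
  rw [← l2Norm_sq, ENNReal.pow_le_pow_left_iff two_ne_zero]

theorem l2Norm_eq_iff {φ : X → ℝ≥0∞} {c : ℝ≥0∞} : l2Norm φ = c ↔ ∑' x, φ x ^ 2 = c ^ 2 := by
  rw [← l2Norm_sq, (ENNReal.pow_right_strictMono two_ne_zero).injective.eq_iff]

theorem l2Norm_mono {φ ψ : X → ℝ≥0∞} (h : ∀ x, φ x ≤ ψ x) : l2Norm φ ≤ l2Norm ψ := by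
  rw [l2Norm_le_iff, l2Norm_sq]
  gcongr
  exact h _

theorem tsum_mul_le_l2Norm_mul_l2Norm (φ ψ : X → ℝ≥0∞) :
    ∑' x, φ x * ψ x ≤ l2Norm φ * l2Norm ψ := by
  rw [ENNReal.tsum_eq_iSup_sum]
  refine iSup_le fun s ↦ (ENNReal.inner_le_Lp_mul_Lq s φ ψ Real.HolderConjugate.two_two).trans ?_
  unfold l2Norm
  gcongr
  · simpa using ENNReal.sum_le_tsum (f := fun x ↦ φ x ^ 2) s
  · simpa using ENNReal.sum_le_tsum (f := fun x ↦ ψ x ^ 2) s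

theorem l2Norm_l2Norm_swap (α : X → Y → ℝ≥0∞) :
    l2Norm (fun y ↦ l2Norm fun x ↦ α x y) = l2Norm fun x ↦ l2Norm (α x) := by
  simp only [l2Norm_eq_iff, l2Norm_sq]
  exact ENNReal.tsum_comm

theorem tsum_tsum_tsum_mul_le (α : X → Y → ℝ≥0∞) (β : Y → Z → ℝ≥0∞) (γ : X → Z → ℝ≥0∞) :
    ∑' x, ∑' y, ∑' z, α x y * β y z * γ x z ≤
      l2Norm (fun x ↦ l2Norm (α x)) * l2Norm (fun y ↦ l2Norm (β y)) *
        l2Norm (fun x ↦ l2Norm (γ x)) := by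
  have inner_le (x : X) : ∑' y, ∑' z, α x y * β y z * γ x z ≤
      l2Norm (α x) * l2Norm (γ x) * l2Norm fun y ↦ l2Norm (β y) :=
    calc ∑' y, ∑' z, α x y * β y z * γ x z
        = ∑' y, α x y * ∑' z, β y z * γ x z := by simp only [mul_assoc, ENNReal.tsum_mul_left]
      _ ≤ ∑' y, α x y * (l2Norm (β y) * l2Norm (γ x)) := by
          gcongr
          exact tsum_mul_le_l2Norm_mul_l2Norm _ _
      _ = (∑' y, α x y * l2Norm (β y)) * l2Norm (γ x) := by
          simp only [← mul_assoc, ENNReal.tsum_mul_right]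
      _ ≤ l2Norm (α x) * l2Norm (fun y ↦ l2Norm (β y)) * l2Norm (γ x) := by
          gcongr
          exact tsum_mul_le_l2Norm_mul_l2Norm _ _
      _ = _ := by ring
  calc ∑' x, ∑' y, ∑' z, α x y * β y z * γ x z
      ≤ ∑' x, l2Norm (α x) * l2Norm (γ x) * l2Norm fun y ↦ l2Norm (β y) := by
        gcongr
        exact inner_le _
    _ = (∑' x, l2Norm (α x) * l2Norm (γ x)) * l2Norm fun y ↦ l2Norm (β y) :=
        ENNReal.tsum_mul_right
    _ ≤ l2Norm (fun x ↦ l2Norm (α x)) * l2Norm (fun x ↦ l2Norm (γ x)) *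
          l2Norm fun y ↦ l2Norm (β y) := by
        gcongr
        exact tsum_mul_le_l2Norm_mul_l2Norm _ _
    _ = _ := by ring

theorem l2Norm_comp_le {e : X → Y} (he : e.Injective) (φ : Y → ℝ≥0∞) :
    l2Norm (fun x ↦ φ (e x)) ≤ l2Norm φ := by
  rw [l2Norm_le_iff, l2Norm_sq]
  exact ENNReal.tsum_comp_le_tsum_of_injective he fun y ↦ φ y ^ 2

theorem l2Norm_indicator_le_of_subsingleton {S : Set X} (hS : S.Subsingleton) (c : ℝ≥0∞) :
    l2Norm (S.indicator fun _ ↦ c) ≤ c := by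
  rw [l2Norm_le_iff]
  rcases hS.eq_empty_or_singleton with rfl | ⟨x, rfl⟩
  · simp
  · rw [tsum_eq_single x fun y hy ↦ by simp [hy]]
    simp

theorem l2Norm_l2Norm_indicator_le {S : X → Set Y} (hS : ∀ x, (S x).Subsingleton)
    (φ : X → ℝ≥0∞) :
    l2Norm (fun y ↦ l2Norm fun x ↦ (S x).indicator (fun _ ↦ φ x) y) ≤ l2Norm φ := by
  rw [l2Norm_l2Norm_swap]
  exact l2Norm_mono fun x ↦ l2Norm_indicator_le_of_subsingleton (hS x) (φ x)

theorem l2Norm_enorm (ξ : L2 X) : l2Norm (fun x ↦ ‖(ξ : X → ℂ) x‖ₑ) = ‖ξ‖ₑ := by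
  have sum_sq : HasSum (fun x ↦ ‖(ξ : X → ℂ) x‖ ^ 2) (‖ξ‖ ^ 2) := by
    simpa using lp.hasSum_norm (by norm_num) ξ
  simp only [l2Norm_eq_iff, ← ofReal_norm, ← ENNReal.ofReal_pow (norm_nonneg _)]
  rw [← ENNReal.ofReal_tsum_of_nonneg (fun _ ↦ by positivity) sum_sq.summable, sum_sq.tsum_eq]

theorem l2Norm_coeff (φ : MonoidAlgebra ℂ X) :
    l2Norm (fun x ↦ ‖φ.coeff x‖ₑ) = ENNReal.ofReal (twoNorm φ) := by
  have vanish (x : X) (hx : x ∉ φ.coeff.support) : ‖φ.coeff x‖ₑ ^ 2 = 0 := by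
    simp [Finsupp.notMem_support_iff.1 hx]
  rw [l2Norm_eq_iff, tsum_eq_sum vanish, twoNorm, ← ENNReal.ofReal_pow (Real.sqrt_nonneg _),
    Real.sq_sqrt (by positivity), ENNReal.ofReal_sum_of_nonneg fun _ _ ↦ by positivity]
  simp only [← ofReal_norm, ENNReal.ofReal_pow (norm_nonneg _)]

end SquareSum

section Decay

variable {K : Type*} [Group K] {B B' : Set K} {C C' : ℝ}

/-- `‖λ(φ)‖ ≤ C ‖φ‖₂` for every `φ ∈ ℂ[K]` supported in `B`. Thus `f`-decay is the estimate with
constant `f n` on the ball of radius `n`, for every `n`. -/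
def DecayOn (B : Set K) (C : ℝ) : Prop :=
  ∀ φ : MonoidAlgebra ℂ K, (∀ x ∈ φ.coeff.support, x ∈ B) → ‖regularRep φ‖ ≤ C * twoNorm φ

theorem HasDecay.decayOn {l : K → ℕ} {f : ℕ → ℝ} (h : HasDecay l f) (n : ℕ) :
    DecayOn {x | l x ≤ n} (f n) :=
  h n

theorem DecayOn.mono (h : DecayOn B C) (hB : B' ⊆ B) (hC : C ≤ C') : DecayOn B' C' := fun φ hφ ↦
  (h φ fun x hx ↦ hB (hφ x hx)).trans
    (mul_le_mul_of_nonneg_right hC (Real.sqrt_nonneg _))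

theorem DecayOn.nonneg (h : DecayOn B C) (hB : B.Nonempty) : 0 ≤ C := by
  obtain ⟨b, hb⟩ := hB
  have bound := h (MonoidAlgebra.ofCoeff (Finsupp.single b 1)) (by simp [hb])
  have norm_single : twoNorm (MonoidAlgebra.ofCoeff (Finsupp.single b (1 : ℂ))) = 1 := by
    simp [twoNorm]
  rw [norm_single, mul_one] at bound
  exact (norm_nonneg _).trans bound

/-- The estimate `∑ φ(a) ψ(b) χ(ab) ≤ C ‖φ‖₂ ‖ψ‖₂ ‖χ‖₂` for non-negative functions on a group,
the first of which is supported in `B`. For finite `C` it is equivalent to `DecayOn B C`, and it is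
the form in which decay is used. -/
def TrilinearBound (B : Set K) (C : ℝ≥0∞) : Prop :=
  ∀ φ ψ χ : K → ℝ≥0, (∀ a, φ a ≠ 0 → a ∈ B) →
    ∑' a, ∑' b, (φ a * ψ b * χ (a * b) : ℝ≥0∞) ≤
      C * (l2Norm (fun a ↦ (φ a : ℝ≥0∞)) * l2Norm (fun a ↦ (ψ a : ℝ≥0∞)) *
        l2Norm (fun a ↦ (χ a : ℝ≥0∞)))

theorem tsum_tsum_mul_eq_tsum_convolution_mul (φ ψ χ : K → ℝ≥0∞) :
    ∑' a, ∑' b, φ a * ψ b * χ (a * b) = ∑' x, (∑' a, φ a * ψ (a⁻¹ * x)) * χ x := by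
  have shift (a : K) : ∑' b, φ a * ψ b * χ (a * b) = ∑' x, φ a * ψ (a⁻¹ * x) * χ x := by
    simpa using (Equiv.mulLeft a).tsum_eq fun x ↦ φ a * ψ (a⁻¹ * x) * χ x
  simp only [shift, ← ENNReal.tsum_mul_right]
  exact ENNReal.tsum_comm

theorem regularRep_apply (φ : MonoidAlgebra ℂ K) (ξ : L2 K) (x : K) :
    (regularRep φ ξ : K → ℂ) x =
      ∑ a ∈ φ.coeff.support, φ.coeff a * (ξ : K → ℂ) (a⁻¹ * x) := by
  rw [regularRep, _root_.sum_apply, lp.coeFn_sum, Finset.sum_apply]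
  rfl

theorem enorm_regularRep_apply_le (φ : MonoidAlgebra ℂ K) (ξ : L2 K) (x : K) :
    ‖(regularRep φ ξ : K → ℂ) x‖ₑ ≤ ∑' a, ‖φ.coeff a‖ₑ * ‖(ξ : K → ℂ) (a⁻¹ * x)‖ₑ := by
  rw [regularRep_apply]
  refine (enorm_sum_le _ _).trans ?_
  simp only [enorm_mul]
  exact ENNReal.sum_le_tsum _

theorem TrilinearBound.decayOn (hC : 0 ≤ C) (h : TrilinearBound B (ENNReal.ofReal C)) :
    DecayOn B C := by
  intro φ hφ
  have twoNorm_nonneg : 0 ≤ twoNorm φ := Real.sqrt_nonneg _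
  refine ContinuousLinearMap.opNorm_le_bound _ (by positivity) fun ξ ↦ ?_
  set η := regularRep φ ξ
  have square_le : ‖η‖ₑ ^ 2 ≤ ENNReal.ofReal (C * twoNorm φ * ‖ξ‖) * ‖η‖ₑ :=
    calc ‖η‖ₑ ^ 2 = ∑' x, ‖(η : K → ℂ) x‖ₑ * ‖(η : K → ℂ) x‖ₑ := by
          rw [← l2Norm_enorm, l2Norm_sq]
          simp only [sq]
      _ ≤ ∑' x, (∑' a, ‖φ.coeff a‖ₑ * ‖(ξ : K → ℂ) (a⁻¹ * x)‖ₑ) * ‖(η : K → ℂ) x‖ₑ := by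
          gcongr
          exact enorm_regularRep_apply_le φ ξ _
      _ = ∑' a, ∑' b, ‖φ.coeff a‖ₑ * ‖(ξ : K → ℂ) b‖ₑ * ‖(η : K → ℂ) (a * b)‖ₑ :=
          (tsum_tsum_mul_eq_tsum_convolution_mul (fun a ↦ ‖φ.coeff a‖ₑ) (fun b ↦ ‖(ξ : K → ℂ) b‖ₑ)
            fun x ↦ ‖(η : K → ℂ) x‖ₑ).symm
      _ ≤ ENNReal.ofReal C * (l2Norm (fun a ↦ ‖φ.coeff a‖ₑ) * l2Norm (fun b ↦ ‖(ξ : K → ℂ) b‖ₑ) *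
            l2Norm fun x ↦ ‖(η : K → ℂ) x‖ₑ) :=
          h (fun a ↦ ‖φ.coeff a‖₊) (fun b ↦ ‖(ξ : K → ℂ) b‖₊) (fun x ↦ ‖(η : K → ℂ) x‖₊)
            fun a ha ↦ hφ a (by simpa using ha)
      _ = ENNReal.ofReal (C * twoNorm φ * ‖ξ‖) * ‖η‖ₑ := by
          rw [l2Norm_coeff, l2Norm_enorm, l2Norm_enorm, ENNReal.ofReal_mul (by positivity),
            ENNReal.ofReal_mul hC, ofReal_norm]
          ring
  rw [← ofReal_norm η, ← ENNReal.ofReal_pow (norm_nonneg _), ← ENNReal.ofReal_mul (by positivity),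
    ENNReal.ofReal_le_ofReal_iff (by positivity), sq] at square_le
  rcases (norm_nonneg η).eq_or_lt with zero_eq | pos
  · rw [← zero_eq]
    positivity
  · exact le_of_mul_le_mul_right square_le pos

theorem enorm_ofReal_coe (t : ℝ≥0) : ‖((t : ℝ) : ℂ)‖ₑ = t := by
  rw [← ofReal_norm]
  simp

theorem exists_lp_coe_eq {X : Type*} (ψ : X →₀ ℂ) : ∃ ξ : L2 X, (ξ : X → ℂ) = ψ := by
  classical
  refine ⟨∑ x ∈ ψ.support, lp.single 2 x (ψ x), funext fun x ↦ ?_⟩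
  rw [lp.coeFn_sum, Finset.sum_apply]
  simp [Pi.single_apply, eq_comm]

theorem enorm_regularRep_apply_of_nonneg {φ : K →₀ ℝ≥0} {ψ : K → ℝ≥0} {Φ : MonoidAlgebra ℂ K}
    {ξ : L2 K} (hΦ : ∀ a, Φ.coeff a = φ a) (hξ : ∀ x, (ξ : K → ℂ) x = ψ x) (x : K) :
    ‖(regularRep Φ ξ : K → ℂ) x‖ₑ = ∑' a, (φ a * ψ (a⁻¹ * x) : ℝ≥0∞) := by
  have support_eq : Φ.coeff.support = φ.support := by
    ext a
    simp [hΦ]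
  have vanish (a : K) (ha : a ∉ φ.support) : (φ a * ψ (a⁻¹ * x) : ℝ≥0∞) = 0 := by
    simp [Finsupp.notMem_support_iff.1 ha]
  rw [regularRep_apply, support_eq, tsum_eq_sum vanish]
  simp only [hΦ, hξ]
  norm_cast
  exact enorm_ofReal_coe _

theorem DecayOn.tsum_tsum_mul_le (h : DecayOn B C) (φ ψ : K →₀ ℝ≥0) (hφ : ∀ a, φ a ≠ 0 → a ∈ B)
    (χ : K → ℝ≥0∞) :
    ∑' a, ∑' b, (φ a * ψ b * χ (a * b) : ℝ≥0∞) ≤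
      ENNReal.ofReal C * (l2Norm (fun a ↦ (φ a : ℝ≥0∞)) * l2Norm (fun a ↦ (ψ a : ℝ≥0∞)) *
        l2Norm χ) := by
  let Φ : MonoidAlgebra ℂ K := .ofCoeff (φ.mapRange (fun t : ℝ≥0 ↦ ((t : ℝ) : ℂ)) (by simp))
  obtain ⟨ξ, hξ⟩ := exists_lp_coe_eq (ψ.mapRange (fun t : ℝ≥0 ↦ ((t : ℝ) : ℂ)) (by simp))
  have Φ_coeff (a : K) : Φ.coeff a = φ a := rfl
  have ξ_apply (x : K) : (ξ : K → ℂ) x = ψ x := congrFun hξ x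
  have norm_Φ : ENNReal.ofReal (twoNorm Φ) = l2Norm fun a ↦ (φ a : ℝ≥0∞) := by
    simp only [← l2Norm_coeff, Φ_coeff, enorm_ofReal_coe]
  have norm_ξ : ‖ξ‖ₑ = l2Norm fun x ↦ (ψ x : ℝ≥0∞) := by
    simp only [← l2Norm_enorm, ξ_apply, enorm_ofReal_coe]
  have norm_Φ_le : ‖regularRep Φ‖ₑ ≤ ENNReal.ofReal C * ENNReal.ofReal (twoNorm Φ) := by
    rw [← ENNReal.ofReal_mul' (show 0 ≤ twoNorm Φ from Real.sqrt_nonneg _), ← ofReal_norm]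
    refine ENNReal.ofReal_le_ofReal (h Φ fun a ha ↦ hφ a fun φ_zero ↦ ?_)
    simp [Φ_coeff, φ_zero] at ha
  calc ∑' a, ∑' b, (φ a * ψ b * χ (a * b) : ℝ≥0∞)
      = ∑' x, ‖(regularRep Φ ξ : K → ℂ) x‖ₑ * χ x := by
        simp only [enorm_regularRep_apply_of_nonneg Φ_coeff ξ_apply]
        exact tsum_tsum_mul_eq_tsum_convolution_mul _ _ _
    _ ≤ l2Norm (fun x ↦ ‖(regularRep Φ ξ : K → ℂ) x‖ₑ) * l2Norm χ :=
        tsum_mul_le_l2Norm_mul_l2Norm _ _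
    _ ≤ ‖regularRep Φ‖ₑ * ‖ξ‖ₑ * l2Norm χ := by
        rw [l2Norm_enorm]
        gcongr
        exact ContinuousLinearMap.le_opENorm _ _
    _ ≤ ENNReal.ofReal C * ENNReal.ofReal (twoNorm Φ) * ‖ξ‖ₑ * l2Norm χ := by gcongr
    _ = _ := by
        rw [norm_Φ, norm_ξ]
        ring

theorem exists_finsupp_eqOn_le {X : Type*} (f : X → ℝ≥0) (s : Finset X) :
    ∃ g : X →₀ ℝ≥0, Set.EqOn g f s ∧ ∀ x, g x ≤ f x := by
  classical
  have apply_eq (x : X) : Finsupp.indicator s (fun x _ ↦ f x) x = if x ∈ s then f x else 0 := by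
    simp [Finsupp.indicator_apply]
  refine ⟨Finsupp.indicator s fun x _ ↦ f x, fun x hx ↦ ?_, fun x ↦ ?_⟩
  · rw [apply_eq, if_pos (Finset.mem_coe.1 hx)]
  · rw [apply_eq]
    split <;> simp

theorem DecayOn.trilinearBound (h : DecayOn B C) : TrilinearBound B (ENNReal.ofReal C) := by
  intro φ ψ χ hφ
  rw [ENNReal.tsum_eq_iSup_sum]
  refine iSup_le fun S ↦ ?_
  rw [← Summable.tsum_finsetSum fun _ _ ↦ ENNReal.summable, ENNReal.tsum_eq_iSup_sum]
  refine iSup_le fun R ↦ ?_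
  obtain ⟨φ', φ'_eq, φ'_le⟩ := exists_finsupp_eqOn_le φ S
  obtain ⟨ψ', ψ'_eq, ψ'_le⟩ := exists_finsupp_eqOn_le ψ R
  have support_subset (a : K) (ha : φ' a ≠ 0) : a ∈ B :=
    hφ a fun zero ↦ ha (le_antisymm (zero ▸ φ'_le a) zero_le)
  calc ∑ b ∈ R, ∑ a ∈ S, (φ a * ψ b * χ (a * b) : ℝ≥0∞)
      = ∑ a ∈ S, ∑ b ∈ R, (φ' a * ψ' b * χ (a * b) : ℝ≥0∞) := by
        rw [Finset.sum_comm]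
        refine Finset.sum_congr rfl fun a ha ↦ Finset.sum_congr rfl fun b hb ↦ ?_
        rw [φ'_eq ha, ψ'_eq hb]
    _ ≤ ∑' a, ∑' b, (φ' a * ψ' b * χ (a * b) : ℝ≥0∞) :=
        (Finset.sum_le_sum fun _ _ ↦ ENNReal.sum_le_tsum R).trans (ENNReal.sum_le_tsum S)
    _ ≤ _ := h.tsum_tsum_mul_le φ' ψ' support_subset fun c ↦ χ c
    _ ≤ _ := by
        gcongr <;> refine l2Norm_mono fun x ↦ ENNReal.coe_le_coe.2 ?_
        · exact φ'_le x
        · exact ψ'_le x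

end Decay

section Transfer

variable {K M V : Type*} [Group K] [Group M] {C : ℝ≥0∞}

theorem TrilinearBound.image {B : Set M} (h : TrilinearBound B C) {ι : M →* K}
    (hι : Function.Injective ι) : TrilinearBound (ι '' B) C := by
  intro φ ψ χ hφ
  obtain ⟨S, hS, -⟩ := ι.range.exists_isComplement_right 1
  let coset (s : S) (f : K → ℝ≥0) (b : M) : ℝ≥0 := f (ι b * s)
  have tsum_eq_tsum_coset (F : K → ℝ≥0∞) : ∑' x, F x = ∑' s : S, ∑' b, F (ι b * s) := by
    rw [← (Equiv.ofBijective _ hS).tsum_eq, ENNReal.tsum_prod', ENNReal.tsum_comm]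
    refine tsum_congr fun s ↦ ?_
    exact ((MonoidHom.ofInjective hι).toEquiv.tsum_eq fun b : ι.range ↦ F (b * s)).symm
  have l2Norm_coset (f : K → ℝ≥0) :
      l2Norm (fun s ↦ l2Norm fun b ↦ (coset s f b : ℝ≥0∞)) = l2Norm fun x ↦ (f x : ℝ≥0∞) := by
    simp only [l2Norm_eq_iff, l2Norm_sq]
    exact (tsum_eq_tsum_coset fun x ↦ (f x : ℝ≥0∞) ^ 2).symm
  have support_subset (F : K → ℝ≥0∞) :
      (Function.support fun a ↦ (φ a : ℝ≥0∞) * F a) ⊆ Set.range ι := fun a ha ↦ by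
    obtain ⟨b, -, rfl⟩ := hφ a fun zero ↦ ha (by simp [zero])
    exact ⟨b, rfl⟩
  calc ∑' a, ∑' x, (φ a * ψ x * χ (a * x) : ℝ≥0∞)
      = ∑' a, ∑' x, (φ (ι a) * ψ x * χ (ι a * x) : ℝ≥0∞) := by
        simp only [mul_assoc, ENNReal.tsum_mul_left]
        exact (hι.tsum_eq (support_subset _)).symm
    _ = ∑' s : S, ∑' a, ∑' b, (φ (ι a) * coset s ψ b * coset s χ (a * b) : ℝ≥0∞) := by
        conv_rhs => rw [ENNReal.tsum_comm]
        refine tsum_congr fun a ↦ ?_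
        rw [tsum_eq_tsum_coset]
        simp only [coset, map_mul, mul_assoc]
    _ ≤ ∑' s : S, C * (l2Norm (fun a ↦ (φ (ι a) : ℝ≥0∞)) *
          l2Norm (fun b ↦ (coset s ψ b : ℝ≥0∞)) * l2Norm fun b ↦ (coset s χ b : ℝ≥0∞)) := by
        refine ENNReal.tsum_le_tsum fun s ↦ h (fun a ↦ φ (ι a)) _ _ fun a ha ↦ ?_
        exact (hι.mem_set_image).1 (hφ _ ha)
    _ = C * (l2Norm (fun a ↦ (φ (ι a) : ℝ≥0∞)) * ∑' s : S,
          l2Norm (fun b ↦ (coset s ψ b : ℝ≥0∞)) * l2Norm fun b ↦ (coset s χ b : ℝ≥0∞)) := by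
        simp only [mul_assoc, ENNReal.tsum_mul_left]
    _ ≤ C * (l2Norm (fun a ↦ (φ a : ℝ≥0∞)) *
          (l2Norm (fun x ↦ (ψ x : ℝ≥0∞)) * l2Norm fun x ↦ (χ x : ℝ≥0∞))) := by
        rw [← l2Norm_coset ψ, ← l2Norm_coset χ]
        gcongr
        · exact l2Norm_comp_le hι fun x ↦ (φ x : ℝ≥0∞)
        · exact tsum_mul_le_l2Norm_mul_l2Norm _ _
    _ = _ := by rw [mul_assoc (l2Norm _)]

variable [MulAction K V] {r : V → K}

open Classical in
/-- The block of `F : V → K → α` with row `v` and column `v'`: the values of `F v` at the elements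
which carry `v'` to `v`, written as functions on `K` by means of the chosen frames `r v` and
`r v'`. -/
noncomputable def block {α : Type*} [Zero α] (r : V → K) (F : V → K → α) (v v' : V) (a : K) : α :=
  if (r v * a * (r v')⁻¹)⁻¹ • v = v' then F v (r v * a * (r v')⁻¹) else 0

theorem block_of_smul_eq {α : Type*} [Zero α] {F : V → K → α} {v v' : V} {a : K}
    (h : (r v * a * (r v')⁻¹)⁻¹ • v = v') : block r F v v' a = F v (r v * a * (r v')⁻¹) :=
  if_pos h

theorem block_of_smul_ne {α : Type*} [Zero α] {F : V → K → α} {v v' : V} {a : K}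
    (h : (r v * a * (r v')⁻¹)⁻¹ • v ≠ v') : block r F v v' a = 0 :=
  if_neg h

theorem coe_block (F : V → K → ℝ≥0) (v v' : V) (a : K) :
    ((block r F v v' a : ℝ≥0) : ℝ≥0∞) = block r (fun v x ↦ (F v x : ℝ≥0∞)) v v' a := by
  unfold block
  split <;> simp

theorem tsum_tsum_block (F : V → K → ℝ≥0∞) (v : V) :
    ∑' v', ∑' a, block r F v v' a = ∑' x, F v x := by
  classical
  have unframe (v' : V) :
      ∑' a, block r F v v' a = ∑' x, if v' = x⁻¹ • v then F v x else 0 := by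
    rw [← ((Equiv.mulLeft (r v)).trans (Equiv.mulRight (r v')⁻¹)).tsum_eq fun x ↦
      if v' = x⁻¹ • v then F v x else 0]
    exact tsum_congr fun a ↦ if_congr eq_comm rfl rfl
  simp only [unframe]
  rw [ENNReal.tsum_comm]
  simp only [tsum_ite_eq]

theorem l2Norm_block (F : V → K → ℝ≥0) :
    l2Norm (fun v ↦ l2Norm fun v' ↦ l2Norm fun a ↦ ((block r F v v' a : ℝ≥0) : ℝ≥0∞)) =
      l2Norm fun v ↦ l2Norm fun x ↦ (F v x : ℝ≥0∞) := by
  have sq_block (v v' : V) (a : K) :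
      ((block r F v v' a : ℝ≥0) : ℝ≥0∞) ^ 2 = block r (fun v x ↦ (F v x : ℝ≥0∞) ^ 2) v v' a := by
    unfold block
    split <;> simp
  simp only [l2Norm_eq_iff, l2Norm_sq, sq_block, tsum_tsum_block]

theorem tsum_mul_smul_eq_tsum_block (Φ Ψ X : V → K → ℝ≥0∞) (v : V) :
    ∑' x, ∑' y, Φ v x * Ψ (x⁻¹ • v) y * X v (x * y) =
      ∑' v', ∑' v'', ∑' a, ∑' b,
        block r Φ v v' a * block r Ψ v' v'' b * block r X v v'' (a * b) := by
  rw [← tsum_tsum_block (r := r) (fun v x ↦ ∑' y, Φ v x * Ψ (x⁻¹ • v) y * X v (x * y)) v]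
  refine tsum_congr fun v' ↦ ?_
  conv_rhs => rw [ENNReal.tsum_comm]
  refine tsum_congr fun a ↦ ?_
  by_cases ha : (r v * a * (r v')⁻¹)⁻¹ • v = v'
  · rw [block_of_smul_eq ha, block_of_smul_eq ha, ha, ← tsum_tsum_block (r := r)
      (fun v' y ↦ Φ v (r v * a * (r v')⁻¹) * Ψ v' y * X v (r v * a * (r v')⁻¹ * y)) v']
    refine tsum_congr fun v'' ↦ tsum_congr fun b ↦ ?_
    by_cases hb : (r v' * b * (r v'')⁻¹)⁻¹ • v' = v''
    · have regroup : r v * (a * b) * (r v'')⁻¹ =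
          r v * a * (r v')⁻¹ * (r v' * b * (r v'')⁻¹) := by group
      have hab : (r v * (a * b) * (r v'')⁻¹)⁻¹ • v = v'' := by
        rw [regroup, mul_inv_rev, mul_smul, ha, hb]
      rw [block_of_smul_eq hb, block_of_smul_eq hb, block_of_smul_eq hab, regroup]
    · simp [block_of_smul_ne hb]
  · simp [block_of_smul_ne ha]

theorem tsum_mul_smul_le {B : V → Set K} (hB : ∀ v, TrilinearBound (B v) C)
    (Φ Ψ X : V → K → ℝ≥0) (hΦ : ∀ v x, Φ v x ≠ 0 → (r v)⁻¹ * x * r (x⁻¹ • v) ∈ B v) :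
    ∑' v, ∑' x, ∑' y, (Φ v x * Ψ (x⁻¹ • v) y * X v (x * y) : ℝ≥0∞) ≤
      C * (l2Norm (fun v ↦ l2Norm fun x ↦ (Φ v x : ℝ≥0∞)) *
        l2Norm (fun v ↦ l2Norm fun x ↦ (Ψ v x : ℝ≥0∞)) *
        l2Norm (fun v ↦ l2Norm fun x ↦ (X v x : ℝ≥0∞))) := by
  have block_mem (v v' : V) (a : K) (ha : block r Φ v v' a ≠ 0) : a ∈ B v := by
    by_cases carries : (r v * a * (r v')⁻¹)⁻¹ • v = v'
    · rw [block_of_smul_eq carries] at ha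
      have mem := hΦ v _ ha
      rw [carries] at mem
      simpa [mul_assoc] using mem
    · exact absurd (block_of_smul_ne carries) ha
  let N (F : V → K → ℝ≥0) (v v' : V) : ℝ≥0∞ := l2Norm fun a ↦ ((block r F v v' a : ℝ≥0) : ℝ≥0∞)
  calc ∑' v, ∑' x, ∑' y, (Φ v x * Ψ (x⁻¹ • v) y * X v (x * y) : ℝ≥0∞)
      = ∑' v, ∑' v', ∑' v'', ∑' a, ∑' b,
          ((block r Φ v v' a : ℝ≥0) * (block r Ψ v' v'' b : ℝ≥0) *
            (block r X v v'' (a * b) : ℝ≥0) : ℝ≥0∞) := by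
        simp only [coe_block]
        exact tsum_congr fun v ↦ tsum_mul_smul_eq_tsum_block (fun v x ↦ (Φ v x : ℝ≥0∞))
          (fun v x ↦ (Ψ v x : ℝ≥0∞)) (fun v x ↦ (X v x : ℝ≥0∞)) v
    _ ≤ ∑' v, ∑' v', ∑' v'', C * (N Φ v v' * N Ψ v' v'' * N X v v'') := by
        gcongr with v v' v''
        exact hB v (block r Φ v v') (block r Ψ v' v'') (block r X v v'') (block_mem v v')
    _ = C * ∑' v, ∑' v', ∑' v'', N Φ v v' * N Ψ v' v'' * N X v v'' := by
        simp only [ENNReal.tsum_mul_left]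
    _ ≤ _ := by
        rw [← l2Norm_block (r := r) Φ, ← l2Norm_block (r := r) Ψ, ← l2Norm_block (r := r) X]
        gcongr
        exact tsum_tsum_tsum_mul_le _ _ _

theorem tsum_indicator_smul_le {B : V → Set K} (hB : ∀ v, TrilinearBound (B v) C)
    {P Q R : K → Set V} (hP : ∀ x, (P x).Subsingleton) (hQ : ∀ y, (Q y).Subsingleton)
    (hR : ∀ z, (R z).Subsingleton) {φ : K → ℝ≥0} (ψ χ : K → ℝ≥0)
    (hφ : ∀ x, φ x ≠ 0 → ∀ v ∈ P x, (r v)⁻¹ * x * r (x⁻¹ • v) ∈ B v) :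
    ∑' v, ∑' x, ∑' y, ((P x).indicator (fun _ ↦ (φ x : ℝ≥0∞)) v *
        (Q y).indicator (fun _ ↦ (ψ y : ℝ≥0∞)) (x⁻¹ • v) *
        (R (x * y)).indicator (fun _ ↦ (χ (x * y) : ℝ≥0∞)) v) ≤
      C * (l2Norm (fun x ↦ (φ x : ℝ≥0∞)) * l2Norm (fun y ↦ (ψ y : ℝ≥0∞)) *
        l2Norm (fun z ↦ (χ z : ℝ≥0∞))) := by
  let select (S : K → Set V) (f : K → ℝ≥0) (v : V) (x : K) : ℝ≥0 := (S x).indicator (fun _ ↦ f x) v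
  have coe_select (S : K → Set V) (f : K → ℝ≥0) (v : V) (x : K) :
      (S x).indicator (fun _ ↦ (f x : ℝ≥0∞)) v = select S f v x := by
    by_cases hv : v ∈ S x <;> simp [select, hv]
  have select_le {S : K → Set V} (hS : ∀ x, (S x).Subsingleton) (f : K → ℝ≥0) :
      l2Norm (fun v ↦ l2Norm fun x ↦ (select S f v x : ℝ≥0∞)) ≤ l2Norm fun x ↦ (f x : ℝ≥0∞) := by
    simp only [← coe_select]
    exact l2Norm_l2Norm_indicator_le hS _
  have framed_mem (v : V) (x : K) (hx : select P φ v x ≠ 0) :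
      (r v)⁻¹ * x * r (x⁻¹ • v) ∈ B v := by
    obtain ⟨hv, φ_ne⟩ := Set.indicator_apply_ne_zero.1 hx
    exact hφ x φ_ne v hv
  simp only [coe_select]
  refine (tsum_mul_smul_le hB _ _ _ framed_mem).trans ?_
  gcongr
  exacts [select_le hP φ, select_le hQ ψ, select_le hR χ]

end Transfer

section Trees

open SimpleGraph

variable {V : Type*} {T : SimpleGraph V} {a b c v w : V}

/-- The metric interval between `a` and `b` in a graph: the set of vertices on geodesics from `a`
to `b`. -/
def interval (T : SimpleGraph V) (a b : V) : Set V :=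
  {v | T.dist a v + T.dist v b = T.dist a b}

theorem mem_interval : v ∈ interval T a b ↔ T.dist a v + T.dist v b = T.dist a b :=
  Iff.rfl

theorem length_eq_dist_of_isPath (hT : T.IsTree) {p : T.Walk a b} (hp : p.IsPath) :
    p.length = T.dist a b := by
  obtain ⟨q, hq, length_q⟩ := hT.connected.exists_path_of_dist a b
  rw [(hT.existsUnique_path a b).unique hp hq, length_q]

theorem exists_isPath_append_of_mem_interval (hT : T.IsTree) (hv : v ∈ interval T a b) :
    ∃ (p : T.Walk a v) (q : T.Walk v b), p.length = T.dist a v ∧ (p.append q).IsPath := by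
  obtain ⟨p, -, length_p⟩ := hT.connected.exists_path_of_dist a v
  obtain ⟨q, -, length_q⟩ := hT.connected.exists_path_of_dist v b
  refine ⟨p, q, length_p, Walk.isPath_of_length_eq_dist _ ?_⟩
  rw [Walk.length_append, length_p, length_q, hv]

theorem mem_support_of_mem_interval (hT : T.IsTree) (hv : v ∈ interval T a b)
    (p : T.Walk a b) : v ∈ p.support := by
  classical
  obtain ⟨q, q', -, hqq'⟩ := exists_isPath_append_of_mem_interval hT hv
  have bypass_eq := (hT.existsUnique_path a b).unique hqq' p.bypass_isPath
  apply p.support_bypass_subset_support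
  simp [← bypass_eq]

theorem mem_interval_of_mem_support (hT : T.IsTree) {p : T.Walk a b} (hp : p.IsPath)
    (hv : v ∈ p.support) : v ∈ interval T a b := by
  classical
  have length_split := congrArg Walk.length (p.take_spec hv)
  rwa [Walk.length_append, length_eq_dist_of_isPath hT (hp.takeUntil hv),
    length_eq_dist_of_isPath hT (hp.dropUntil hv), length_eq_dist_of_isPath hT hp] at length_split

theorem getVert_dist_of_mem_interval (hT : T.IsTree) {p : T.Walk a b} (hp : p.IsPath)
    (hv : v ∈ interval T a b) : p.getVert (T.dist a v) = v := by
  obtain ⟨q, q', length_q, hqq'⟩ := exists_isPath_append_of_mem_interval hT hv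
  rw [(hT.existsUnique_path a b).unique hp hqq', Walk.getVert_append, length_q]
  simp

theorem subsingleton_interval_inter_sphere (hT : T.IsTree) (a b : V) (n : ℕ) :
    (interval T a b ∩ {v | T.dist a v = n}).Subsingleton := by
  rintro v ⟨hv, dist_v⟩ w ⟨hw, dist_w⟩
  obtain ⟨p, hp, -⟩ := hT.connected.exists_path_of_dist a b
  rw [← getVert_dist_of_mem_interval hT hp hv, ← getVert_dist_of_mem_interval hT hp hw,
    show T.dist a v = n from dist_v, show T.dist a w = n from dist_w]

theorem interval_subset_union (hT : T.IsTree) (a b c : V) :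
    interval T a c ⊆ interval T a b ∪ interval T b c := by
  intro v hv
  obtain ⟨p, hp, -⟩ := hT.connected.exists_path_of_dist a b
  obtain ⟨q, hq, -⟩ := hT.connected.exists_path_of_dist b c
  rcases (Walk.mem_support_append_iff p q).1 (mem_support_of_mem_interval hT hv (p.append q)) with
    hv | hv
  · exact Or.inl (mem_interval_of_mem_support hT hp hv)
  · exact Or.inr (mem_interval_of_mem_support hT hq hv)

theorem interval_self (hT : T.Connected) (a : V) : interval T a a = {a} := by
  ext v
  simp [interval, hT.dist_eq_zero_iff, eq_comm]

theorem interval_subset_pair_of_adj (hT : T.Connected) (h : T.Adj a b) :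
    interval T a b ⊆ {a, b} := by
  intro v hv
  rw [mem_interval, dist_eq_one_iff_adj.2 h] at hv
  rcases Nat.eq_zero_or_pos (T.dist a v) with zero | pos
  · exact Or.inl (hT.dist_eq_zero_iff.1 zero).symm
  · exact Or.inr (hT.dist_eq_zero_iff.1 (by lia))

theorem isPath_append {p : T.Walk a b} {q : T.Walk b c} (hp : p.IsPath)
    (hq : q.IsPath) (h : ∀ x ∈ p.support, x ∈ q.support → x = b) : (p.append q).IsPath := by
  rw [Walk.isPath_def, Walk.support_append]
  refine List.Nodup.append hp.support_nodup hq.support_nodup.tail fun x hxp hxq ↦ ?_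
  have nodup := hq.support_nodup
  rw [← Walk.cons_tail_support, List.nodup_cons] at nodup
  exact nodup.1 (h x hxp (List.mem_of_mem_tail hxq) ▸ hxq)

/-- The vertex of the path from `a` to `b` nearest to `c` is the median. -/
theorem exists_mem_interval_inter_inter (hT : T.IsTree) (a b c : V) :
    (interval T a b ∩ interval T a c ∩ interval T b c).Nonempty := by
  classical
  obtain ⟨p, hp, -⟩ := hT.connected.exists_path_of_dist a b
  obtain ⟨w, hw, nearest⟩ := p.support.toFinset.exists_min_image (fun v ↦ T.dist v c)
    ⟨a, by simp⟩
  simp only [List.mem_toFinset] at hw nearest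
  obtain ⟨q, hq, -⟩ := hT.connected.exists_path_of_dist w c
  have meet_only_at_w (x : V) (hxp : x ∈ p.support) (hxq : x ∈ q.support) : x = w := by
    have hx := mem_interval.1 (mem_interval_of_mem_support hT hq hxq)
    have := nearest x hxp
    exact (hT.connected.dist_eq_zero_iff.1 (by lia)).symm
  have left_isPath := isPath_append (hp.takeUntil hw) hq fun x hx hxq ↦
    meet_only_at_w x (p.support_takeUntil_subset_support hw hx) hxq
  have right_isPath := isPath_append (hp.dropUntil hw).reverse hq fun x hx hxq ↦
    meet_only_at_w x (p.support_dropUntil_subset_support hw (by simpa using hx)) hxq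
  exact ⟨w, ⟨mem_interval_of_mem_support hT hp hw,
    mem_interval_of_mem_support hT left_isPath (by simp)⟩,
    mem_interval_of_mem_support hT right_isPath (by simp)⟩

end Trees

section TreeAction

variable {K V : Type*} [Group K] [MulAction K V] {T : SimpleGraph V} {o : V} {r : V → K}
  {B : V → Set K} {C : ℝ≥0∞} {E : Set K} {D : ℕ}

theorem inv_smul_mem_interval (dist_smul : ∀ (k : K) v w, T.dist (k • v) (k • w) = T.dist v w)
    {k : K} {a b v : V} : k⁻¹ • v ∈ interval T a b ↔ v ∈ interval T (k • a) (k • b) := by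
  rw [mem_interval, mem_interval, ← dist_smul k a, ← dist_smul k _ b, smul_inv_smul, dist_smul]

theorem exists_mem_interval_smul (hT : T.IsTree)
    (dist_smul : ∀ (k : K) v w, T.dist (k • v) (k • w) = T.dist v w) (o : V) (x y : K) :
    ∃ v, v ∈ interval T o (x • o) ∧ x⁻¹ • v ∈ interval T o (y • o) ∧
      v ∈ interval T o ((x * y) • o) := by
  obtain ⟨v, ⟨hx, hxy⟩, hy⟩ := exists_mem_interval_inter_inter hT o (x • o) ((x * y) • o)
  rw [mul_smul x y o] at hy
  exact ⟨v, hx, (inv_smul_mem_interval dist_smul).2 hy, hxy⟩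

theorem dist_inv_smul_le_of_mem_interval
    (dist_smul : ∀ (k : K) v w, T.dist (k • v) (k • w) = T.dist v w) {x : K} {v : V}
    (hv : v ∈ interval T o (x • o)) : T.dist o (x⁻¹ • v) ≤ T.dist o (x • o) := by
  rw [← dist_smul x o (x⁻¹ • v), smul_inv_smul, T.dist_comm, ← mem_interval.1 hv]
  exact Nat.le_add_left _ _

/-- The vertex at distance `n` from `o` on the geodesic from `o` to `x • o`, as a set with at most
one element. -/
def geodesicPoint (T : SimpleGraph V) (o : V) (n : ℕ) (x : K) : Set V :=
  interval T o (x • o) ∩ {v | T.dist o v = n}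

/-- The term `φ(x) ψ(y) χ(xy)` if `v` is at distances `i.1` and `i.2` from `o` and `x • o`, and
lies on the geodesics between any two of `o`, `x • o` and `(x * y) • o`; otherwise `0`. It is
written as a product of functions of `x`, of `y` and of `x * y`. -/
noncomputable def medianTerm (T : SimpleGraph V) (o : V) (φ ψ χ : K → ℝ≥0) (i : ℕ × ℕ) (v : V)
    (x y : K) : ℝ≥0∞ :=
  (geodesicPoint T o i.1 x).indicator (fun _ ↦ (φ x : ℝ≥0∞)) v *
    (geodesicPoint T o i.2 y).indicator (fun _ ↦ (ψ y : ℝ≥0∞)) (x⁻¹ • v) *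
      (geodesicPoint T o i.1 (x * y)).indicator (fun _ ↦ (χ (x * y) : ℝ≥0∞)) v

theorem mul_le_sum_medianTerm (hT : T.IsTree)
    (dist_smul : ∀ (k : K) v w, T.dist (k • v) (k • w) = T.dist v w) (φ ψ χ : K → ℝ≥0) {x : K}
    (hx : T.dist o (x • o) ≤ D) (y : K) :
    (φ x * ψ y * χ (x * y) : ℝ≥0∞) ≤ ∑ i ∈ Finset.range (D + 1) ×ˢ Finset.range (D + 1),
      ∑' v, medianTerm T o φ ψ χ i v x y := by
  obtain ⟨v, hvx, hvy, hvxy⟩ := exists_mem_interval_smul hT dist_smul o x y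
  let i : ℕ × ℕ := (T.dist o v, T.dist o (x⁻¹ • v))
  have hi : i ∈ Finset.range (D + 1) ×ˢ Finset.range (D + 1) := by
    simp only [i, Finset.mem_product, Finset.mem_range_succ_iff]
    exact ⟨((Nat.le_add_right _ _).trans (mem_interval.1 hvx).le).trans hx,
      (dist_inv_smul_le_of_mem_interval dist_smul hvx).trans hx⟩
  calc (φ x * ψ y * χ (x * y) : ℝ≥0∞)
      = medianTerm T o φ ψ χ i v x y := by
        simp [medianTerm, geodesicPoint, i, hvx, hvy, hvxy]
    _ ≤ ∑' v', medianTerm T o φ ψ χ i v' x y := ENNReal.le_tsum v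
    _ ≤ _ := Finset.single_le_sum (f := fun i ↦ ∑' v', medianTerm T o φ ψ χ i v' x y)
        (fun _ _ ↦ zero_le) hi

/-- The sum over `x` and `y` is organised by the median `v` of `o`, `x • o` and `(x * y) • o`. Once
the distances from `v` to `o` and `x • o` are fixed, for which there are `(D + 1) ^ 2`
possibilities, `v` is determined by `x` and by `x * y`, and `x⁻¹ • v` by `y`. -/
theorem TrilinearBound.of_tree_action (hT : T.IsTree)
    (dist_smul : ∀ (k : K) v w, T.dist (k • v) (k • w) = T.dist v w)
    (hB : ∀ v, TrilinearBound (B v) C) (hED : ∀ x ∈ E, T.dist o (x • o) ≤ D)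
    (hEB : ∀ x ∈ E, ∀ v ∈ interval T o (x • o), (r v)⁻¹ * x * r (x⁻¹ • v) ∈ B v) :
    TrilinearBound E ((D + 1) ^ 2 * C) := by
  intro φ ψ χ hφ
  have le_sum_medianTerm (x y : K) : (φ x * ψ y * χ (x * y) : ℝ≥0∞) ≤
      ∑ i ∈ Finset.range (D + 1) ×ˢ Finset.range (D + 1),
        ∑' v, medianTerm T o φ ψ χ i v x y := by
    by_cases hx : x ∈ E
    · exact mul_le_sum_medianTerm hT dist_smul φ ψ χ (hED x hx) y
    · simp [not_not.1 (mt (hφ x) hx)]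
  have unique (n : ℕ) (x : K) : (geodesicPoint T o n x).Subsingleton :=
    subsingleton_interval_inter_sphere hT o (x • o) n
  calc ∑' x, ∑' y, (φ x * ψ y * χ (x * y) : ℝ≥0∞)
      ≤ ∑' x, ∑' y, ∑ i ∈ Finset.range (D + 1) ×ˢ Finset.range (D + 1),
          ∑' v, medianTerm T o φ ψ χ i v x y :=
        ENNReal.tsum_le_tsum fun x ↦ ENNReal.tsum_le_tsum (le_sum_medianTerm x)
    _ = ∑ i ∈ Finset.range (D + 1) ×ˢ Finset.range (D + 1),
          ∑' v, ∑' x, ∑' y, medianTerm T o φ ψ χ i v x y := by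
        simp only [Summable.tsum_finsetSum fun _ _ ↦ ENNReal.summable]
        refine Finset.sum_congr rfl fun i _ ↦ ?_
        rw [ENNReal.tsum_comm (α := V)]
        exact tsum_congr fun x ↦ ENNReal.tsum_comm
    _ ≤ ∑ _i ∈ Finset.range (D + 1) ×ˢ Finset.range (D + 1),
          C * (l2Norm (fun x ↦ (φ x : ℝ≥0∞)) * l2Norm (fun y ↦ (ψ y : ℝ≥0∞)) *
            l2Norm (fun z ↦ (χ z : ℝ≥0∞))) :=
        Finset.sum_le_sum fun i _ ↦ tsum_indicator_smul_le hB (unique i.1) (unique i.2)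
          (unique i.1) ψ χ fun x hx v hv ↦ hEB x (hφ x hx) v hv.1
    _ = _ := by
        rw [Finset.sum_const, Finset.card_product, Finset.card_range, nsmul_eq_mul]
        push_cast
        ring

end TreeAction

section BassSerre

open SimpleGraph symmDiff
open scoped Pointwise

theorem isBridge_of_cut {V : Type*} {T : SimpleGraph V} {a b : V} {S : Set V}
    (hab : ¬(a ∈ S ↔ b ∈ S)) (hS : ∀ v w, T.Adj v w → s(a, b) ≠ s(v, w) → (v ∈ S ↔ w ∈ S)) :
    T.IsBridge s(a, b) := by
  rw [isBridge_iff]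
  rintro ⟨p⟩
  have mem_iff : ∀ {v w}, (T.deleteEdges {s(a, b)}).Walk v w → (v ∈ S ↔ w ∈ S) := by
    intro v w q
    induction q with
    | nil => rfl
    | cons h _ ih =>
      rw [deleteEdges_adj, Set.mem_singleton_iff] at h
      exact (hS _ _ h.1 (Ne.symm h.2)).trans ih
  exact hab (mem_iff p)

theorem dist_map_le {V W : Type*} {T : SimpleGraph V} {T' : SimpleGraph W} (hT : T.Connected)
    (f : T →g T') (a b : V) : T'.dist (f a) (f b) ≤ T.dist a b := by
  obtain ⟨p, hp⟩ := hT.exists_walk_length_eq_dist a b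
  rw [← hp, ← Walk.length_map f p]
  exact dist_le _

theorem dist_map_iso {V W : Type*} {T : SimpleGraph V} {T' : SimpleGraph W} (hT : T.Connected)
    (e : T ≃g T') (a b : V) : T'.dist (e a) (e b) = T.dist a b := by
  refine le_antisymm (dist_map_le hT e.toHom a b) ?_
  simpa using! dist_map_le (e.connected_iff.1 hT) e.symm.toHom (e a) (e b)

variable {G H : Type u} {A : Type v} [Group G] [Group H] [Group A] (i : A →* G) (j : A →* H)

/-- The map from the common subgroup `A` into `G *_A H`. -/
def Amalgam.baseHom : A →* Amalgam i j := Monoid.PushoutI.base (pairHom i j)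

theorem Amalgam.inl_base (a : A) : Amalgam.inl i j (i a) = Amalgam.baseHom i j a :=
  Monoid.PushoutI.of_apply_eq_base (pairHom i j) false a

theorem Amalgam.inr_base (a : A) : Amalgam.inr i j (j a) = Amalgam.baseHom i j a :=
  Monoid.PushoutI.of_apply_eq_base (pairHom i j) true a

theorem Amalgam.inl_injective (hi : Function.Injective i) (hj : Function.Injective j) :
    Function.Injective (Amalgam.inl i j) :=
  Monoid.PushoutI.of_injective (φ := pairHom i j) (fun b ↦ by cases b <;> assumption) false

theorem Amalgam.inr_injective (hi : Function.Injective i) (hj : Function.Injective j) :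
    Function.Injective (Amalgam.inr i j) :=
  Monoid.PushoutI.of_injective (φ := pairHom i j) (fun b ↦ by cases b <;> assumption) true

theorem Amalgam.exists_lift {P : Type*} [Group P] (f : G →* P) (h : H →* P)
    (hfh : ∀ a, f (i a) = h (j a)) :
    ∃ F : Amalgam i j →* P, (∀ x, F (Amalgam.inl i j x) = f x) ∧
      ∀ y, F (Amalgam.inr i j y) = h y := by
  let fam : ∀ b, Pair G H b →* P := fun b ↦ match b with
    | false => f
    | true => h
  have fam_comp : ∀ b, (fam b).comp (pairHom i j b) = f.comp i := by
    intro b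
    cases b
    · rfl
    · exact MonoidHom.ext fun a ↦ (hfh a).symm
  exact ⟨Monoid.PushoutI.lift fam (f.comp i) fam_comp,
    fun x ↦ Monoid.PushoutI.lift_of fam _ fam_comp (i := false) x,
    fun y ↦ Monoid.PushoutI.lift_of fam _ fam_comp (i := true) y⟩

variable {i j} in
theorem Amalgam.induction_on {p : Amalgam i j → Prop} (k : Amalgam i j)
    (inl : ∀ x, p (Amalgam.inl i j x)) (inr : ∀ y, p (Amalgam.inr i j y))
    (mul : ∀ k k', p k → p k' → p (k * k')) : p k := by
  induction k using Monoid.PushoutI.induction_on with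
  | of b x =>
    cases b
    · exact inl x
    · exact inr x
  | base a =>
    rw [← Amalgam.baseHom, ← Amalgam.inl_base]
    exact inl (i a)
  | mul k k' hk hk' => exact mul k k' hk hk'

/-- Cutting the Bass–Serre tree at the edge `A` splits `G *_A H` into a left `G`-invariant set and
its complement, and moving `A` to the other side makes the splitting left `H`-invariant. -/
theorem exists_smul_eq_self_and_smul_symmDiff_eq_self :
    ∃ E : Set (Amalgam i j), (∀ x, Amalgam.inl i j x • E = E) ∧
      ∀ y, Amalgam.inr i j y • (E ∆ Set.range (Amalgam.baseHom i j)) =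
        E ∆ Set.range (Amalgam.baseHom i j) := by
  set A₀ : Set (Amalgam i j) := Set.range (Amalgam.baseHom i j)
  have smul_A₀ : ∀ a, Amalgam.baseHom i j a • A₀ = A₀ := fun a ↦
    smul_coe_set (s := (Amalgam.baseHom i j).range) ⟨a, rfl⟩
  let flip : Equiv.Perm (Set (Amalgam i j)) := (symmDiff_left_involutive A₀).toPerm
  let ρ := MulAction.toPermHom (Amalgam i j) (Set (Amalgam i j))
  -- `H` acts by the regular action conjugated by `S ↦ S ∆ A₀`; on `A` this changes nothing.
  obtain ⟨F, F_inl, F_inr⟩ := Amalgam.exists_lift i j (ρ.comp (Amalgam.inl i j))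
    ((MulAut.conj flip).toMonoidHom.comp (ρ.comp (Amalgam.inr i j))) fun a => Equiv.ext fun S ↦ by
      change Amalgam.inl i j (i a) • S = (Amalgam.inr i j (j a) • (S ∆ A₀)) ∆ A₀
      rw [Amalgam.inl_base, Amalgam.inr_base, Set.smul_set_symmDiff, smul_A₀,
        symmDiff_symmDiff_cancel_right]
  have F_inl_mul : ∀ x k, F (Amalgam.inl i j x * k) ∅ = Amalgam.inl i j x • F k ∅ := by
    intro x k
    rw [map_mul, F_inl]
    rfl
  have F_inr_mul : ∀ y k, F (Amalgam.inr i j y * k) ∅ =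
      (Amalgam.inr i j y • (F k ∅ ∆ A₀)) ∆ A₀ := by
    intro y k
    rw [map_mul, F_inr]
    rfl
  refine ⟨{k | k ∈ F k ∅}, fun x ↦ Set.ext fun k ↦ ?_, fun y ↦ Set.ext fun k ↦ ?_⟩
  · rw [Set.mem_smul_set_iff_inv_smul_mem, Set.mem_ofPred_eq, Set.mem_ofPred_eq, smul_eq_mul,
      ← map_inv, F_inl_mul, map_inv, ← smul_eq_mul, Set.smul_mem_smul_set_iff]
  · have mem_iff : ∀ k, k ∈ {k | k ∈ F k ∅} ∆ A₀ ↔ k ∈ F k ∅ ∆ A₀ := fun _ ↦ Iff.rfl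
    rw [Set.mem_smul_set_iff_inv_smul_mem, mem_iff, mem_iff, smul_eq_mul, ← map_inv, F_inr_mul,
      symmDiff_symmDiff_cancel_right, map_inv, ← smul_eq_mul, Set.smul_mem_smul_set_iff]

/-- The vertices of the Bass–Serre tree: the left cosets of `G` and of `H`. -/
abbrev BassSerreVertex : Type _ :=
  (Amalgam i j ⧸ (Amalgam.inl i j).range) ⊕ (Amalgam i j ⧸ (Amalgam.inr i j).range)

/-- The vertex `kG` of the Bass–Serre tree. -/
def leftVertex (k : Amalgam i j) : BassSerreVertex i j := Sum.inl (k : _ ⧸ _)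

/-- The vertex `kH` of the Bass–Serre tree. -/
def rightVertex (k : Amalgam i j) : BassSerreVertex i j := Sum.inr (k : _ ⧸ _)

/-- The Bass–Serre tree of `G *_A H`: the vertices are the cosets of `G` and of `H`, and there is
an edge from `kG` to `kH` for each `k`. -/
def bassSerreTree : SimpleGraph (BassSerreVertex i j) where
  Adj v w := ∃ k, (v = leftVertex i j k ∧ w = rightVertex i j k) ∨
    (v = rightVertex i j k ∧ w = leftVertex i j k)
  symm := ⟨by
    rintro v w ⟨k, h | h⟩
    · exact ⟨k, Or.inr ⟨h.2, h.1⟩⟩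
    · exact ⟨k, Or.inl ⟨h.2, h.1⟩⟩⟩
  loopless := ⟨by rintro v ⟨k, ⟨rfl, h⟩ | ⟨rfl, h⟩⟩ <;> cases h⟩

theorem bassSerreTree_adj (k : Amalgam i j) :
    (bassSerreTree i j).Adj (leftVertex i j k) (rightVertex i j k) :=
  ⟨k, Or.inl ⟨rfl, rfl⟩⟩

theorem leftVertex_mul_inl (k : Amalgam i j) (x : G) :
    leftVertex i j (k * Amalgam.inl i j x) = leftVertex i j k :=
  congrArg Sum.inl (QuotientGroup.eq.2 ⟨x⁻¹, by simp⟩)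

theorem rightVertex_mul_inr (k : Amalgam i j) (y : H) :
    rightVertex i j (k * Amalgam.inr i j y) = rightVertex i j k :=
  congrArg Sum.inr (QuotientGroup.eq.2 ⟨y⁻¹, by simp⟩)

theorem exists_mk_mem_iff_inv_mul_mem {K : Type*} [Group K] (Q : Subgroup K) {D : Set K}
    (k₀ : K) (hD : ∀ q ∈ Q, q • D = D) :
    ∃ S : Set (K ⧸ Q), ∀ k : K, (k : K ⧸ Q) ∈ S ↔ k⁻¹ * k₀ ∈ D := by
  refine ⟨{v | Quotient.lift (fun k : K ↦ k⁻¹ * k₀ ∈ D) (fun k k' h ↦ ?_) v}, fun k ↦ Iff.rfl⟩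
  have mem_iff := Set.smul_mem_smul_set_iff (a := k⁻¹ * k') (s := D) (x := k'⁻¹ * k₀)
  rw [hD _ (QuotientGroup.leftRel_apply.1 h), smul_eq_mul, mul_assoc,
    mul_inv_cancel_left] at mem_iff
  exact propext mem_iff

/-- The half of the Bass–Serre tree on one side of the edge `k₀A`. -/
theorem exists_halfTree (k₀ : Amalgam i j) : ∃ S : Set (BassSerreVertex i j),
    ∀ k, (leftVertex i j k ∈ S ↔ rightVertex i j k ∈ S) ↔
      k⁻¹ * k₀ ∉ Set.range (Amalgam.baseHom i j) := by
  obtain ⟨E, E_inl, E_inr⟩ := exists_smul_eq_self_and_smul_symmDiff_eq_self i j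
  obtain ⟨S, hS⟩ := exists_mk_mem_iff_inv_mul_mem (Amalgam.inl i j).range k₀ (D := E) <| by
    rintro _ ⟨x, rfl⟩
    exact E_inl x
  obtain ⟨S', hS'⟩ := exists_mk_mem_iff_inv_mul_mem (Amalgam.inr i j).range k₀
      (D := E ∆ Set.range (Amalgam.baseHom i j)) <| by
    rintro _ ⟨y, rfl⟩
    exact E_inr y
  refine ⟨{v | Sum.elim (· ∈ S) (· ∈ S') v}, fun k ↦ ?_⟩
  change ((k : _ ⧸ _) ∈ S ↔ (k : _ ⧸ _) ∈ S') ↔ _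
  rw [hS, hS', Set.mem_symmDiff]
  tauto

theorem bassSerreTree_isAcyclic : (bassSerreTree i j).IsAcyclic := by
  have isBridge (k₀) : (bassSerreTree i j).IsBridge s(leftVertex i j k₀, rightVertex i j k₀) := by
    obtain ⟨S, hS⟩ := exists_halfTree i j k₀
    have separated : ¬(leftVertex i j k₀ ∈ S ↔ rightVertex i j k₀ ∈ S) := fun h ↦
      (hS k₀).1 h ⟨1, by simp⟩
    have same_side (k) (hk : s(leftVertex i j k₀, rightVertex i j k₀) ≠
        s(leftVertex i j k, rightVertex i j k)) :
        leftVertex i j k ∈ S ↔ rightVertex i j k ∈ S := by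
      refine (hS k).2 fun ⟨a, ha⟩ ↦ hk ?_
      have left_eq : leftVertex i j k₀ = leftVertex i j k := by
        rw [← leftVertex_mul_inl i j k (i a), Amalgam.inl_base, ha, mul_inv_cancel_left]
      have right_eq : rightVertex i j k₀ = rightVertex i j k := by
        rw [← rightVertex_mul_inr i j k (j a), Amalgam.inr_base, ha, mul_inv_cancel_left]
      rw [left_eq, right_eq]
    have same_side_of_adj (v w) (h : (bassSerreTree i j).Adj v w)
        (hvw : s(leftVertex i j k₀, rightVertex i j k₀) ≠ s(v, w)) : v ∈ S ↔ w ∈ S := by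
      obtain ⟨k, ⟨rfl, rfl⟩ | ⟨rfl, rfl⟩⟩ := h
      · exact same_side k hvw
      · exact (same_side k fun h ↦ hvw (h.trans Sym2.eq_swap)).symm
    exact isBridge_of_cut separated same_side_of_adj
  rw [isAcyclic_iff_forall_adj_isBridge]
  rintro v w ⟨k, ⟨rfl, rfl⟩ | ⟨rfl, rfl⟩⟩
  · exact isBridge k
  · exact Sym2.eq_swap ▸ isBridge k

theorem bassSerreTree_connected : (bassSerreTree i j).Connected := by
  have reachable_mul (k' : Amalgam i j) : ∀ k, (bassSerreTree i j).Reachable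
      (leftVertex i j k) (leftVertex i j (k * k')) := by
    induction k' using Amalgam.induction_on with
    | inl x => exact fun k ↦ by rw [leftVertex_mul_inl]
    | inr y =>
      intro k
      have := (bassSerreTree_adj i j (k * Amalgam.inr i j y)).symm.reachable
      rw [rightVertex_mul_inr] at this
      exact (bassSerreTree_adj i j k).reachable.trans this
    | mul k₁ k₂ h₁ h₂ => exact fun k ↦ (h₁ k).trans (by rw [← mul_assoc]; exact h₂ _)
  have reachable_left (k) :
      (bassSerreTree i j).Reachable (leftVertex i j 1) (leftVertex i j k) := by
    simpa using reachable_mul k 1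
  refine (connected_iff_exists_forall_reachable _).2 ⟨leftVertex i j 1, ?_⟩
  rintro (v | v)
  · obtain ⟨k, rfl⟩ := QuotientGroup.mk_surjective v
    exact reachable_left k
  · obtain ⟨k, rfl⟩ := QuotientGroup.mk_surjective v
    exact (reachable_left k).trans (bassSerreTree_adj i j k).reachable

theorem bassSerreTree_isTree : (bassSerreTree i j).IsTree :=
  ⟨bassSerreTree_connected i j, bassSerreTree_isAcyclic i j⟩

/-- The automorphism of the Bass–Serre tree by which an element of `G *_A H` acts. -/
def bassSerreIso (k : Amalgam i j) : bassSerreTree i j ≃g bassSerreTree i j where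
  toEquiv := MulAction.toPerm k
  map_rel_iff' := by
    have adj_smul (k : Amalgam i j) {v w : BassSerreVertex i j} (h : (bassSerreTree i j).Adj v w) :
        (bassSerreTree i j).Adj (k • v) (k • w) := by
      obtain ⟨k', ⟨rfl, rfl⟩ | ⟨rfl, rfl⟩⟩ := h
      · exact ⟨k * k', Or.inl ⟨rfl, rfl⟩⟩
      · exact ⟨k * k', Or.inr ⟨rfl, rfl⟩⟩
    exact fun {v w} ↦ ⟨fun h ↦ by simpa using adj_smul k⁻¹ h, adj_smul k⟩

theorem smul_leftVertex (k k' : Amalgam i j) :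
    k • leftVertex i j k' = leftVertex i j (k * k') :=
  rfl

theorem smul_rightVertex (k k' : Amalgam i j) :
    k • rightVertex i j k' = rightVertex i j (k * k') :=
  rfl

theorem bassSerreTree_dist_smul (k : Amalgam i j) (v w : BassSerreVertex i j) :
    (bassSerreTree i j).dist (k • v) (k • w) = (bassSerreTree i j).dist v w :=
  dist_map_iso (bassSerreTree_connected i j) (bassSerreIso i j k) v w

end BassSerre

section UniversalLength

variable {G H : Type u} {A : Type v} [Group G] [Group H] [Group A] {i : A →* G} {j : A →* H}
  {LG LG' : G → ℕ} {LH LH' : H → ℕ}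

theorem universalLength_le_sum (w : List (G ⊕ H)) :
    universalLength i j LG LH (w.map (Sum.elim (Amalgam.inl i j) (Amalgam.inr i j))).prod ≤
      (w.map (Sum.elim LG LH)).sum :=
  Nat.sInf_le ⟨w, rfl, rfl⟩

theorem exists_word_sum_eq_universalLength (LG : G → ℕ) (LH : H → ℕ) (k : Amalgam i j) :
    ∃ w : List (G ⊕ H), (w.map (Sum.elim (Amalgam.inl i j) (Amalgam.inr i j))).prod = k ∧
      (w.map (Sum.elim LG LH)).sum = universalLength i j LG LH k := by
  obtain ⟨w, hw⟩ : ∃ w : List (G ⊕ H),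
      (w.map (Sum.elim (Amalgam.inl i j) (Amalgam.inr i j))).prod = k := by
    induction k using Amalgam.induction_on with
    | inl x => exact ⟨[Sum.inl x], by simp⟩
    | inr y => exact ⟨[Sum.inr y], by simp⟩
    | mul k k' hk hk' =>
      obtain ⟨w, rfl⟩ := hk
      obtain ⟨w', rfl⟩ := hk'
      exact ⟨w ++ w', by simp⟩
  exact Nat.sInf_mem (s := {n | ∃ w : List (G ⊕ H),
    (w.map (Sum.elim (Amalgam.inl i j) (Amalgam.inr i j))).prod = k ∧
    (w.map (Sum.elim LG LH)).sum = n}) ⟨_, w, hw, rfl⟩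

theorem universalLength_one : universalLength i j LG LH 1 = 0 :=
  Nat.le_zero.1 (universalLength_le_sum [])

theorem universalLength_inl_le (x : G) : universalLength i j LG LH (Amalgam.inl i j x) ≤ LG x := by
  simpa using universalLength_le_sum (i := i) (j := j) (LG := LG) (LH := LH) [Sum.inl x]

theorem universalLength_inr_le (y : H) : universalLength i j LG LH (Amalgam.inr i j y) ≤ LH y := by
  simpa using universalLength_le_sum (i := i) (j := j) (LG := LG) (LH := LH) [Sum.inr y]

theorem universalLength_mul_le (k k' : Amalgam i j) : universalLength i j LG LH (k * k') ≤
    universalLength i j LG LH k + universalLength i j LG LH k' := by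
  obtain ⟨w, rfl, hw⟩ := exists_word_sum_eq_universalLength LG LH k
  obtain ⟨w', rfl, hw'⟩ := exists_word_sum_eq_universalLength LG LH k'
  rw [← hw, ← hw', ← List.sum_append, ← List.prod_append, ← List.map_append, ← List.map_append]
  exact universalLength_le_sum _

theorem universalLength_induction {p : Amalgam i j → ℕ → Prop} (one : p 1 0)
    (inl_mul : ∀ x k n, p k n → p (Amalgam.inl i j x * k) (LG x + n))
    (inr_mul : ∀ y k n, p k n → p (Amalgam.inr i j y * k) (LH y + n)) (k : Amalgam i j) :
    p k (universalLength i j LG LH k) := by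
  obtain ⟨w, rfl, hw⟩ := exists_word_sum_eq_universalLength LG LH k
  rw [← hw]
  clear hw
  induction w with
  | nil => exact one
  | cons x w ih =>
    cases x with
    | inl x => simpa using inl_mul x _ _ ih
    | inr y => simpa using inr_mul y _ _ ih

theorem le_universalLength {l : Amalgam i j → ℕ} (one : l 1 = 0)
    (mul_le : ∀ k k', l (k * k') ≤ l k + l k') (inl_le : ∀ x, l (Amalgam.inl i j x) ≤ LG x)
    (inr_le : ∀ y, l (Amalgam.inr i j y) ≤ LH y) (k : Amalgam i j) :
    l k ≤ universalLength i j LG LH k := by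
  induction k using universalLength_induction (LG := LG) (LH := LH) with
  | one => exact one.le
  | inl_mul x k n ih => exact (mul_le _ _).trans (add_le_add (inl_le x) ih)
  | inr_mul y k n ih => exact (mul_le _ _).trans (add_le_add (inr_le y) ih)

theorem universalLength_mono (hG : ∀ x, LG x ≤ LG' x) (hH : ∀ y, LH y ≤ LH' y)
    (k : Amalgam i j) : universalLength i j LG LH k ≤ universalLength i j LG' LH' k :=
  le_universalLength universalLength_one universalLength_mul_le
    (fun x ↦ (universalLength_inl_le x).trans (hG x))
    (fun y ↦ (universalLength_inr_le y).trans (hH y)) k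

theorem isLength_universalLength (hLG : IsLength LG) (hLH : IsLength LH) :
    IsLength (universalLength i j LG LH) where
  map_one := universalLength_one
  map_mul_le := universalLength_mul_le
  map_inv := by
    have inv_le (k : Amalgam i j) :
        universalLength i j LG LH k⁻¹ ≤ universalLength i j LG LH k := by
      refine le_universalLength (l := fun k ↦ universalLength i j LG LH k⁻¹)
        (by simp [universalLength_one]) (fun k k' ↦ ?_) (fun x ↦ ?_) (fun y ↦ ?_) k
      · rw [mul_inv_rev, add_comm]
        exact universalLength_mul_le _ _
      · rw [← map_inv, ← hLG.map_inv]
        exact universalLength_inl_le _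
      · rw [← map_inv, ← hLH.map_inv]
        exact universalLength_inr_le _
    exact fun k ↦ (inv_le k).antisymm (by simpa using inv_le k⁻¹)

end UniversalLength

section Geodesics

variable {G H : Type u} {A : Type v} [Group G] [Group H] [Group A] {i : A →* G} {j : A →* H}
  {LG : G → ℕ} {LH : H → ℕ}

theorem leftVertex_inr_eq_of_mem_range {y : H} (hy : y ∈ j.range) :
    leftVertex i j (Amalgam.inr i j y) = leftVertex i j 1 := by
  obtain ⟨a, rfl⟩ := hy
  rw [Amalgam.inr_base, ← Amalgam.inl_base, ← leftVertex_mul_inl i j 1 (i a), one_mul]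

theorem rightVertex_adj_leftVertex_inr (y : H) :
    (bassSerreTree i j).Adj (rightVertex i j 1) (leftVertex i j (Amalgam.inr i j y)) := by
  rw [← rightVertex_mul_inr i j 1 y, one_mul]
  exact (bassSerreTree_adj i j _).symm

theorem dist_leftVertex_le (hpos : ∀ y, y ∉ j.range → 1 ≤ LH y) (k : Amalgam i j) :
    (bassSerreTree i j).dist (leftVertex i j 1) (leftVertex i j k) ≤
      2 * universalLength i j LG LH k := by
  have dist_mul_le (k' k : Amalgam i j) :
      (bassSerreTree i j).dist (leftVertex i j 1) (leftVertex i j (k' * k)) ≤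
        (bassSerreTree i j).dist (leftVertex i j 1) (leftVertex i j k') +
          (bassSerreTree i j).dist (leftVertex i j 1) (leftVertex i j k) := by
    refine ((bassSerreTree_connected i j).dist_triangle (v := leftVertex i j k')).trans ?_
    rw [← bassSerreTree_dist_smul i j k' (leftVertex i j 1) (leftVertex i j k), smul_leftVertex,
      smul_leftVertex, mul_one]
  have dist_inr_le (y : H) :
      (bassSerreTree i j).dist (leftVertex i j 1) (leftVertex i j (Amalgam.inr i j y)) ≤
        2 * LH y := by
    by_cases hy : y ∈ j.range
    · simp [leftVertex_inr_eq_of_mem_range hy]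
    · have dist_le := (bassSerreTree_connected i j).dist_triangle (u := leftVertex i j 1)
        (v := rightVertex i j 1) (w := leftVertex i j (Amalgam.inr i j y))
      rw [SimpleGraph.dist_eq_one_iff_adj.2 (bassSerreTree_adj i j 1),
        SimpleGraph.dist_eq_one_iff_adj.2 (rightVertex_adj_leftVertex_inr y)] at dist_le
      linarith [hpos y hy]
  induction k using universalLength_induction (LG := LG) (LH := LH) with
  | one => simp
  | inl_mul x k n ih =>
    refine (dist_mul_le _ _).trans ?_
    rw [← one_mul (Amalgam.inl i j x), leftVertex_mul_inl, SimpleGraph.dist_self]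
    omega
  | inr_mul y k n ih =>
    have := dist_mul_le (Amalgam.inr i j y) k
    have := dist_inr_le y
    omega

theorem mem_interval_leftVertex_inl {x : G} {v : BassSerreVertex i j}
    (hv : v ∈ interval (bassSerreTree i j) (leftVertex i j 1)
      (leftVertex i j (Amalgam.inl i j x))) :
    v = leftVertex i j 1 := by
  rwa [← one_mul (Amalgam.inl i j x), leftVertex_mul_inl,
    interval_self (bassSerreTree_connected i j)] at hv

theorem mem_interval_leftVertex_inr {y : H} {v : BassSerreVertex i j}
    (hv : v ∈ interval (bassSerreTree i j) (leftVertex i j 1)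
      (leftVertex i j (Amalgam.inr i j y))) :
    (v = leftVertex i j 1 ∨ v = rightVertex i j 1) ∨ v = leftVertex i j (Amalgam.inr i j y) := by
  have connected := bassSerreTree_connected i j
  rcases interval_subset_union (bassSerreTree_isTree i j) _ (rightVertex i j 1) _ hv with hv | hv
  · exact Or.inl (interval_subset_pair_of_adj connected (bassSerreTree_adj i j 1) hv)
  · exact (interval_subset_pair_of_adj connected (rightVertex_adj_leftVertex_inr y) hv).imp_left
      Or.inr

/-- A shortest word for `k` visits every vertex of the geodesic from `G` to `kG`. -/
theorem exists_mul_eq_of_mem_interval (LG : G → ℕ) (LH : H → ℕ) {k : Amalgam i j}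
    {v : BassSerreVertex i j}
    (hv : v ∈ interval (bassSerreTree i j) (leftVertex i j 1) (leftVertex i j k)) :
    ∃ p q, p * q = k ∧ (v = leftVertex i j p ∨ v = rightVertex i j p) ∧
      universalLength i j LG LH p + universalLength i j LG LH q ≤ universalLength i j LG LH k := by
  let L := universalLength i j LG LH
  let path (k : Amalgam i j) := interval (bassSerreTree i j) (leftVertex i j 1) (leftVertex i j k)
  let Splits (k : Amalgam i j) (n : ℕ) : Prop := ∀ v ∈ path k,
    ∃ p q, p * q = k ∧ (v = leftVertex i j p ∨ v = rightVertex i j p) ∧ L p + L q ≤ n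
  have splits_mul {a k : Amalgam i j} {c n : ℕ} (hc : L a ≤ c) (hk : Splits k n)
      (ha : ∀ v ∈ path a, (v = leftVertex i j 1 ∨ v = rightVertex i j 1) ∨ v = leftVertex i j a) :
      Splits (a * k) (c + n) := by
    intro v hv
    have mul_le (q : Amalgam i j) : L (a * q) ≤ c + L q :=
      (universalLength_mul_le a q).trans (Nat.add_le_add_right hc _)
    have le_n : L k ≤ n := by
      obtain ⟨p, q, rfl, -, le⟩ := hk (leftVertex i j 1) (by simp [path, mem_interval])
      exact (universalLength_mul_le p q).trans le
    rcases interval_subset_union (bassSerreTree_isTree i j) _ (leftVertex i j a) _ hv with hv | hv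
    · rcases ha v hv with h | h
      · refine ⟨1, a * k, one_mul _, h, ?_⟩
        have one : L 1 = 0 := universalLength_one
        linarith [mul_le k]
      · exact ⟨a, k, rfl, Or.inl h, add_le_add hc le_n⟩
    · obtain ⟨p, q, rfl, hp, le⟩ := hk (a⁻¹ • v) <|
        (inv_smul_mem_interval (bassSerreTree_dist_smul i j)).2 <| by
          rwa [smul_leftVertex, smul_leftVertex, mul_one]
      exact ⟨a * p, q, mul_assoc _ _ _, hp.imp inv_smul_eq_iff.1 inv_smul_eq_iff.1,
        by linarith [mul_le p]⟩
  suffices Splits k (L k) from this v hv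
  refine universalLength_induction ?_ (fun x k n ih ↦ ?_) (fun y k n ih ↦ ?_) k
  · intro v hv
    simp only [path, interval_self (bassSerreTree_connected i j), Set.mem_singleton_iff] at hv
    exact ⟨1, 1, one_mul 1, Or.inl hv, by simp [L, universalLength_one]⟩
  · exact splits_mul (universalLength_inl_le x) ih fun v hv ↦
      Or.inl (Or.inl (mem_interval_leftVertex_inl hv))
  · exact splits_mul (universalLength_inr_le y) ih fun v hv ↦ mem_interval_leftVertex_inr hv

theorem exists_minimal_representative {K M : Type*} [Group K] [Group M] (ι : M →* K) (l : K → ℕ) :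
    ∃ r : K ⧸ ι.range → K, ∀ k : K, (∃ m, r k = k * ι m) ∧ l (r k) ≤ l k := by
  have nonempty (v : K ⧸ ι.range) : {k : K | (k : K ⧸ ι.range) = v}.Nonempty :=
    QuotientGroup.mk_surjective v
  refine ⟨fun v ↦ Function.argminOn l _ (nonempty v), fun k ↦
    ⟨?_, Function.argminOn_le l _ (by rfl)⟩⟩
  obtain ⟨m, hm⟩ := QuotientGroup.eq.1 (Function.argminOn_mem l _ (nonempty k)).symm
  exact ⟨m, by rw [hm, mul_inv_cancel_left]⟩

theorem inv_mul_mul_mem_image {K M : Type*} [Group K] [Group M] {ι : M →* K} {l : K → ℕ}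
    (hl : IsLength l) {r : K ⧸ ι.range → K}
    (hr : ∀ k : K, (∃ m, r k = k * ι m) ∧ l (r k) ≤ l k) {p q : K} {n : ℕ} (h : l p + l q ≤ n) :
    (r (p : K))⁻¹ * (p * q) * r (q⁻¹ : K) ∈ ι '' {m | l (ι m) ≤ 2 * n} := by
  obtain ⟨⟨a, ha⟩, le_p⟩ := hr p
  obtain ⟨⟨b, hb⟩, le_q⟩ := hr q⁻¹
  have eq_map : (r (p : K))⁻¹ * (p * q) * r (q⁻¹ : K) = ι (a⁻¹ * b) := by
    rw [ha, hb, map_mul, map_inv]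
    group
  refine ⟨a⁻¹ * b, ?_, eq_map.symm⟩
  rw [Set.mem_ofPred_eq, ← eq_map]
  have := hl.map_mul_le ((r (p : K))⁻¹ * (p * q)) (r (q⁻¹ : K))
  have := hl.map_mul_le (r (p : K))⁻¹ (p * q)
  rw [hl.map_inv] at this le_q
  linarith [hl.map_mul_le p q]

theorem decayOn_universalLength_le (hi : Function.Injective i) (hj : Function.Injective j)
    (hLG : IsLength LG) (hLH : IsLength LH) (hpos : ∀ y, y ∉ j.range → 1 ≤ LH y) {n : ℕ} {C : ℝ}
    (hG : DecayOn {x | universalLengthLeft i j LG LH x ≤ 2 * n} C)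
    (hH : DecayOn {y | universalLengthRight i j LG LH y ≤ 2 * n} C) :
    DecayOn {k | universalLength i j LG LH k ≤ n} ((2 * n + 1) ^ 2 * C) := by
  have hL : IsLength (universalLength i j LG LH) := isLength_universalLength hLG hLH
  obtain ⟨rG, hrG⟩ := exists_minimal_representative (Amalgam.inl i j) (universalLength i j LG LH)
  obtain ⟨rH, hrH⟩ := exists_minimal_representative (Amalgam.inr i j) (universalLength i j LG LH)
  let B : BassSerreVertex i j → Set (Amalgam i j) := Sum.elim
    (fun _ ↦ Amalgam.inl i j '' {x | universalLengthLeft i j LG LH x ≤ 2 * n})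
    (fun _ ↦ Amalgam.inr i j '' {y | universalLengthRight i j LG LH y ≤ 2 * n})
  have trilinearBound : TrilinearBound {k | universalLength i j LG LH k ≤ n}
      (((2 * n : ℕ) + 1) ^ 2 * ENNReal.ofReal C) := by
    refine TrilinearBound.of_tree_action (o := leftVertex i j 1) (r := Sum.elim rG rH) (B := B)
      (bassSerreTree_isTree i j) (bassSerreTree_dist_smul i j) ?_ (fun k hk ↦ ?_) ?_
    · rintro (_ | _)
      · exact hG.trilinearBound.image (Amalgam.inl_injective i j hi hj)
      · exact hH.trilinearBound.image (Amalgam.inr_injective i j hi hj)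
    · rw [smul_leftVertex, mul_one]
      exact (dist_leftVertex_le hpos k).trans (Nat.mul_le_mul_left 2 hk)
    · intro k hk v hv
      rw [smul_leftVertex, mul_one] at hv
      obtain ⟨p, q, rfl, rfl | rfl, le⟩ := exists_mul_eq_of_mem_interval LG LH hv
      · rw [smul_leftVertex, mul_inv_rev, inv_mul_cancel_right]
        exact inv_mul_mul_mem_image hL hrG (le.trans hk)
      · rw [smul_rightVertex, mul_inv_rev, inv_mul_cancel_right]
        exact inv_mul_mul_mem_image hL hrH (le.trans hk)
  have C_nonneg : 0 ≤ C := hG.nonneg ⟨1, by simp [universalLengthLeft, universalLength_one]⟩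
  refine TrilinearBound.decayOn (by positivity) ?_
  convert trilinearBound
  rw [ENNReal.ofReal_mul (by positivity), ENNReal.ofReal_pow (by positivity)]
  congr 2
  norm_cast

end Geodesics

section Growth

open Asymptotics Filter Topology

theorem exists_eval_le_mul_pow (P : Polynomial ℝ) :
    ∃ c k : ℕ, ∀ n : ℕ, P.eval (n : ℝ) ≤ c * ((n : ℝ) + 1) ^ k := by
  refine ⟨⌈∑ m ∈ Finset.range (P.natDegree + 1), |P.coeff m|⌉₊, P.natDegree, fun n ↦ ?_⟩
  have pow_le (m : ℕ) (hm : m ∈ Finset.range (P.natDegree + 1)) :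
      (n : ℝ) ^ m ≤ ((n : ℝ) + 1) ^ P.natDegree :=
    (pow_le_pow_left₀ n.cast_nonneg (by linarith) m).trans
      (pow_le_pow_right₀ (by simp) (Finset.mem_range_succ_iff.1 hm))
  calc P.eval (n : ℝ)
      = ∑ m ∈ Finset.range (P.natDegree + 1), P.coeff m * (n : ℝ) ^ m :=
        Polynomial.eval_eq_sum_range _
    _ ≤ ∑ m ∈ Finset.range (P.natDegree + 1), |P.coeff m| * ((n : ℝ) + 1) ^ P.natDegree :=
        Finset.sum_le_sum fun m hm ↦
          mul_le_mul (le_abs_self _) (pow_le m hm) (by positivity) (abs_nonneg _)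
    _ = (∑ m ∈ Finset.range (P.natDegree + 1), |P.coeff m|) * ((n : ℝ) + 1) ^ P.natDegree :=
        (Finset.sum_mul _ _ _).symm
    _ ≤ _ := by
        gcongr
        exact Nat.le_ceil _

/-- `f(n) = O(exp(ε n))` for every `ε > 0`. Unlike `Subexponential`, this is stable under sums,
products and upper bounds; the two notions agree for functions with values in `[1, ∞)`. -/
def SubexpBounded (f : ℕ → ℝ) : Prop :=
  ∀ ε : ℝ, 0 < ε → f =O[atTop] fun n : ℕ ↦ Real.exp (ε * n)

namespace SubexpBounded

variable {f g : ℕ → ℝ}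

theorem natCast_pow (k : ℕ) : SubexpBounded fun n ↦ (n : ℝ) ^ k := fun _ hε ↦
  ((isLittleO_pow_exp_pos_mul_atTop k hε).comp_tendsto tendsto_natCast_atTop_atTop).isBigO

theorem const (c : ℝ) : SubexpBounded fun _ ↦ c := fun ε hε ↦ by
  simpa using (natCast_pow 0 ε hε).const_mul_left c

theorem add (hf : SubexpBounded f) (hg : SubexpBounded g) : SubexpBounded fun n ↦ f n + g n :=
  fun ε hε ↦ (hf ε hε).add (hg ε hε)

theorem mul (hf : SubexpBounded f) (hg : SubexpBounded g) : SubexpBounded fun n ↦ f n * g n :=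
  fun ε hε ↦ ((hf (ε / 2) (half_pos hε)).mul (hg (ε / 2) (half_pos hε))).congr_right fun n ↦ by
    rw [← Real.exp_add, ← add_mul, add_halves]

theorem pow (hf : SubexpBounded f) (k : ℕ) : SubexpBounded fun n ↦ f n ^ k := by
  induction k with
  | zero => simpa using const 1
  | succ k ih => simpa only [pow_succ] using ih.mul hf

theorem exists_abs_le (hf : SubexpBounded f) {ε : ℝ} (hε : 0 < ε) :
    ∃ C : ℝ, 0 < C ∧ ∀ n : ℕ, |f n| ≤ C * Real.exp (ε * n) := by
  obtain ⟨C, C_pos, bound⟩ := bound_of_isBigO_nat_atTop (hf ε hε)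
  exact ⟨C, C_pos, fun n ↦ by simpa using bound (Real.exp_ne_zero (ε * n))⟩

theorem comp_affine (hf : SubexpBounded f) (a b : ℕ) : SubexpBounded fun n ↦ f (a * n + b) := by
  intro ε hε
  obtain ⟨C, C_pos, bound⟩ := hf.exists_abs_le (ε := ε / (a + 1)) (by positivity)
  have slope_le : ε / (a + 1) * a ≤ ε := by
    rw [div_mul_eq_mul_div, div_le_iff₀ (by positivity)]
    linarith
  refine IsBigO.of_bound (C * Real.exp (ε / (a + 1) * b)) (.of_forall fun n ↦ ?_)
  calc ‖f (a * n + b)‖ ≤ C * Real.exp (ε / (a + 1) * (a * n + b : ℕ)) := bound _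
    _ = C * Real.exp (ε / (a + 1) * b + ε / (a + 1) * a * n) := by
        push_cast
        ring_nf
    _ ≤ C * Real.exp (ε / (a + 1) * b + ε * n) := by gcongr
    _ = C * Real.exp (ε / (a + 1) * b) * ‖Real.exp (ε * n)‖ := by
        rw [Real.exp_add, mul_assoc, Real.norm_of_nonneg (Real.exp_nonneg _)]

theorem partialSups (hf : SubexpBounded f) : SubexpBounded (_root_.partialSups f) := by
  intro ε hε
  obtain ⟨C, C_pos, bound⟩ := hf.exists_abs_le hε
  refine IsBigO.of_bound C (.of_forall fun n ↦ ?_)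
  rw [Real.norm_eq_abs, Real.norm_of_nonneg (Real.exp_nonneg _)]
  refine abs_le.2 ⟨(abs_le.1 (bound n)).1.trans (le_partialSups f n),
    partialSups_le f n _ fun m hm ↦ ?_⟩
  calc f m ≤ C * Real.exp (ε * m) := (abs_le.1 (bound m)).2
    _ ≤ C * Real.exp (ε * n) := by gcongr

theorem eventually_le_exp (hf : SubexpBounded f) {ε : ℝ} (hε : 0 < ε) :
    ∀ᶠ n : ℕ in atTop, f n ≤ Real.exp (ε * n) := by
  have isLittleO : f =o[atTop] fun n : ℕ ↦ Real.exp (ε * n) := by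
    refine (hf (ε / 2) (half_pos hε)).trans_isLittleO
      ((Real.isLittleO_exp_comp_exp_comp).2 ?_)
    simp only [← sub_mul, sub_half]
    exact tendsto_natCast_atTop_atTop.const_mul_atTop (half_pos hε)
  filter_upwards [isLittleO.bound one_pos] with n hn
  simpa using (le_abs_self _).trans hn

theorem subexponential (hf : SubexpBounded f) (one_le : ∀ n, 1 ≤ f n) : Subexponential f := by
  refine ⟨fun n ↦ zero_le_one.trans (one_le n), tendsto_order.2 ⟨fun a ha ↦ ?_, fun a ha ↦ ?_⟩⟩
  · exact .of_forall fun n ↦ ha.trans_le (Real.one_le_rpow (one_le n) (by positivity))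
  · have log_pos := Real.log_pos ha
    filter_upwards [hf.eventually_le_exp (half_pos log_pos), eventually_ne_atTop 0] with n hn n_ne
    calc f n ^ (1 / (n : ℝ)) ≤ Real.exp (Real.log a / 2 * n) ^ (1 / (n : ℝ)) :=
          Real.rpow_le_rpow (zero_le_one.trans (one_le n)) hn (by positivity)
      _ = Real.exp (Real.log a / 2) := by
          rw [← Real.exp_mul]
          field_simp
      _ < a := by
          rw [← Real.lt_log_iff_exp_lt (by linarith)]
          exact half_lt_self log_pos

end SubexpBounded

theorem Subexponential.subexpBounded {f : ℕ → ℝ} (hf : Subexponential f) : SubexpBounded f := by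
  intro ε hε
  have root_lt : ∀ᶠ n : ℕ in atTop, f n ^ (1 / (n : ℝ)) < Real.exp ε :=
    hf.2.eventually_lt_const (Real.one_lt_exp_iff.2 hε)
  refine IsBigO.of_bound 1 ?_
  filter_upwards [root_lt, eventually_ne_atTop 0] with n hn n_ne
  rw [Real.norm_of_nonneg (hf.1 n), Real.norm_of_nonneg (Real.exp_nonneg _), one_mul]
  calc f n = (f n ^ (1 / (n : ℝ))) ^ n := by
        rw [one_div, Real.rpow_inv_natCast_pow (hf.1 n) n_ne]
    _ ≤ Real.exp ε ^ n := pow_le_pow_left₀ (Real.rpow_nonneg (hf.1 n) _) hn.le n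
    _ = Real.exp (ε * n) := by rw [mul_comm, Real.exp_nat_mul]

end Growth

section ChangeOfLength

variable {K : Type*} [Group K] {l l' : K → ℕ} {f f' : ℕ → ℝ}

theorem HasDecay.mono (h : HasDecay l f) (hf : ∀ n, f n ≤ f' n) : HasDecay l f' := fun n ↦
  (h.decayOn n).mono subset_rfl (hf n)

theorem HasDecay.comp_of_le (h : HasDecay l f) {R : ℕ → ℕ} (hR : Monotone R)
    (hl : ∀ x, l x ≤ R (l' x)) : HasDecay l' (f ∘ R) := fun n ↦
  (h.decayOn (R n)).mono (fun x hx ↦ (hl x).trans (hR hx)) le_rfl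

theorem hasRDWith_iff : HasRDWith l ↔ ∃ c k : ℕ, HasDecay l fun n ↦ c * ((n : ℝ) + 1) ^ k := by
  constructor
  · rintro ⟨P, hP⟩
    obtain ⟨c, k, le⟩ := exists_eval_le_mul_pow P
    exact ⟨c, k, hP.mono le⟩
  · rintro ⟨c, k, h⟩
    exact ⟨(c : Polynomial ℝ) * (Polynomial.X + 1) ^ k, by simpa using h⟩

theorem hasSDWith_iff : HasSDWith l ↔ ∃ f, SubexpBounded f ∧ HasDecay l f := by
  constructor
  · rintro ⟨f, hf, h⟩
    exact ⟨f, hf.subexpBounded, h⟩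
  · rintro ⟨f, hf, h⟩
    have bounded : SubexpBounded fun n ↦ |f n| + 1 :=
      .add (fun ε hε ↦ (hf ε hε).abs_left) (.const 1)
    exact ⟨_, bounded.subexponential fun n ↦ le_add_of_nonneg_left (abs_nonneg _),
      h.mono fun n ↦ (le_abs_self _).trans (le_add_of_nonneg_right zero_le_one)⟩

theorem HasRDWith.mono (h : HasRDWith l) (hl : ∀ x, l x ≤ l' x) : HasRDWith l' :=
  h.imp fun _ hP ↦ hP.comp_of_le monotone_id hl

theorem HasSDWith.mono (h : HasSDWith l) (hl : ∀ x, l x ≤ l' x) : HasSDWith l' :=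
  h.imp fun _ ↦ And.imp_right fun hf ↦ hf.comp_of_le monotone_id hl

theorem HasRDWith.of_polynomiallyDistorted (h : HasRDWith l) (hd : PolynomiallyDistorted l' l) :
    HasRDWith l' := by
  obtain ⟨c, k, decay⟩ := hasRDWith_iff.1 h
  obtain ⟨P, hP⟩ := hd
  obtain ⟨d, m, le⟩ := exists_eval_le_mul_pow P
  have monotone : Monotone fun n ↦ d * (n + 1) ^ m := fun a b hab ↦ by
    dsimp only
    gcongr
  refine ⟨(c : Polynomial ℝ) * ((d : Polynomial ℝ) * (Polynomial.X + 1) ^ m + 1) ^ k, ?_⟩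
  simpa [Function.comp_def] using decay.comp_of_le monotone fun x ↦ by
    exact_mod_cast (hP x).2.trans (le _)

theorem HasRDWith.hasSDWith_of_subexponentiallyDistorted (h : HasRDWith l)
    (hd : SubexponentiallyDistorted l' l) : HasSDWith l' := by
  obtain ⟨c, k, decay⟩ := hasRDWith_iff.1 h
  obtain ⟨g, hg, hgl⟩ := hd
  have sup_nonneg (n : ℕ) : 0 ≤ partialSups g n := (hg.1 n).trans (le_partialSups g n)
  have monotone : Monotone fun n ↦ ⌊partialSups g n⌋₊ := fun a b hab ↦
    Nat.floor_mono ((partialSups g).monotone hab)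
  refine hasSDWith_iff.2 ⟨fun n ↦ c * (partialSups g n + 1) ^ k,
    .mul (.const c) ((hg.subexpBounded.partialSups.add (.const 1)).pow k), ?_⟩
  refine (decay.comp_of_le monotone fun x ↦ ?_).mono fun n ↦ ?_
  · exact Nat.le_floor ((hgl x).2.trans (le_partialSups g _))
  · rw [Function.comp_apply]
    gcongr
    exact Nat.floor_le (sup_nonneg n)

theorem HasSDWith.of_linearlyDistorted (h : HasSDWith l) (hd : LinearlyDistorted l' l) :
    HasSDWith l' := by
  obtain ⟨f, hf, decay⟩ := hasSDWith_iff.1 h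
  obtain ⟨C, D, hCD⟩ := hd
  have monotone : Monotone fun n ↦ ⌈C⌉₊ * n + ⌈D⌉₊ := fun a b hab ↦ by
    dsimp only
    gcongr
  refine hasSDWith_iff.2 ⟨_, hf.comp_affine _ _, decay.comp_of_le monotone fun x ↦ ?_⟩
  have real_le : (l x : ℝ) ≤ ⌈C⌉₊ * l' x + ⌈D⌉₊ :=
    calc (l x : ℝ) ≤ C * l' x + D := (hCD x).2
      _ ≤ ⌈C⌉₊ * l' x + ⌈D⌉₊ := by gcongr <;> exact Nat.le_ceil _
  exact_mod_cast real_le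

theorem IsLength.exists_ge_one_le_of_notMem (hl : IsLength l) (N : Subgroup K) :
    ∃ l' : K → ℕ, IsLength l' ∧ (∀ x, l x ≤ l' x) ∧ ∀ x, x ∉ N → 1 ≤ l' x := by
  classical
  refine ⟨fun x ↦ l x + if x ∈ N then 0 else 1, ⟨?_, fun x ↦ ?_, fun x y ↦ ?_⟩,
    fun x ↦ Nat.le_add_right _ _, fun x hx ↦ by simp [hx]⟩
  · simp [hl.map_one, N.one_mem]
  · simp [hl.map_inv]
  · have mul_le := hl.map_mul_le x y
    have mul_mem : x ∈ N → y ∈ N → x * y ∈ N := N.mul_mem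
    split_ifs <;> grind

end ChangeOfLength

section Amalgam

variable {G H : Type u} {A : Type v} [Group G] [Group H] [Group A] {i : A →* G} {j : A →* H}
  {LG : G → ℕ} {LH : H → ℕ}

theorem sq_le_rpow_seven_halves {x y : ℝ} (hx : 1 ≤ x) (hxy : x ≤ y) :
    x ^ 2 ≤ y ^ (7 / 2 : ℝ) :=
  calc x ^ 2 ≤ y ^ 2 := by gcongr
    _ = y ^ (2 : ℝ) := by norm_cast
    _ ≤ _ := Real.rpow_le_rpow_of_exponent_le (hx.trans hxy) (by norm_num)

theorem decayOn_universalLength_of_distorted (hi : Function.Injective i)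
    (hj : Function.Injective j) (hLG : IsLength LG) (hLH : IsLength LH)
    (hpos : ∀ y, y ∉ j.range → 1 ≤ LH y) {f : ℕ → ℝ} {g : ℕ → ℕ} (hg : Monotone g)
    (hfG : HasDecay LG f) (hfH : HasDecay LH f)
    (hG : Distorted (fun n ↦ (g n : ℝ)) (universalLengthLeft i j LG LH) LG)
    (hH : Distorted (fun n ↦ (g n : ℝ)) (universalLengthRight i j LG LH) LH)
    {n m R : ℕ} (hnm : n ≤ m) (hR : g (2 * n) ≤ R) :
    DecayOn {k | universalLength i j LG LH k ≤ n}
      ((2 * (m : ℝ) + 1) ^ (7 / 2 : ℝ) * f R) := by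
  have decayOn : DecayOn {k | universalLength i j LG LH k ≤ n} ((2 * (n : ℝ) + 1) ^ 2 * f R) :=
    decayOn_universalLength_le hi hj hLG hLH hpos
      ((hfG.decayOn R).mono (fun x hx ↦ (Nat.cast_le.1 (hG x).2).trans ((hg hx).trans hR)) le_rfl)
      ((hfH.decayOn R).mono (fun y hy ↦ (Nat.cast_le.1 (hH y).2).trans ((hg hy).trans hR)) le_rfl)
  have f_nonneg : 0 ≤ f R := (hfG.decayOn R).nonneg ⟨1, by simp [hLG.map_one]⟩
  refine decayOn.mono subset_rfl (mul_le_mul_of_nonneg_right ?_ f_nonneg)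
  exact sq_le_rpow_seven_halves (by simp) (by gcongr)

theorem hasDecay_universalLength (hi : Function.Injective i) (hj : Function.Injective j)
    (hLG : IsLength LG) (hLH : IsLength LH) (hpos : ∀ y, y ∉ j.range → 1 ≤ LH y)
    {fG fH : ℕ → ℝ} (hG : HasDecay (universalLengthLeft i j LG LH) fG)
    (hH : HasDecay (universalLengthRight i j LG LH) fH) :
    HasDecay (universalLength i j LG LH) fun n ↦
      (2 * n + 1) ^ 2 * max (fG (2 * n)) (fH (2 * n)) := fun n ↦
  decayOn_universalLength_le hi hj hLG hLH hpos
    ((hG.decayOn (2 * n)).mono subset_rfl (le_max_left _ _))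
    ((hH.decayOn (2 * n)).mono subset_rfl (le_max_right _ _))

theorem hasRDWith_universalLength (hi : Function.Injective i) (hj : Function.Injective j)
    (hLG : IsLength LG) (hLH : IsLength LH) (hpos : ∀ y, y ∉ j.range → 1 ≤ LH y)
    (hG : HasRDWith (universalLengthLeft i j LG LH))
    (hH : HasRDWith (universalLengthRight i j LG LH)) :
    HasRDWith (universalLength i j LG LH) := by
  obtain ⟨c, k, hck⟩ := hasRDWith_iff.1 hG
  obtain ⟨d, m, hdm⟩ := hasRDWith_iff.1 hH
  refine ⟨(2 * Polynomial.X + 1) ^ 2 * ((c : Polynomial ℝ) * (2 * Polynomial.X + 1) ^ k +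
    (d : Polynomial ℝ) * (2 * Polynomial.X + 1) ^ m), ?_⟩
  refine (hasDecay_universalLength hi hj hLG hLH hpos hck hdm).mono fun n ↦ ?_
  simp only [Polynomial.eval_mul, Polynomial.eval_pow, Polynomial.eval_add, Polynomial.eval_X,
    Polynomial.eval_ofNat, Polynomial.eval_one, Polynomial.eval_natCast, Nat.cast_mul,
    Nat.cast_ofNat]
  gcongr
  exact max_le_add_of_nonneg (by positivity) (by positivity)

theorem hasSDWith_universalLength (hi : Function.Injective i) (hj : Function.Injective j)
    (hLG : IsLength LG) (hLH : IsLength LH) (hpos : ∀ y, y ∉ j.range → 1 ≤ LH y)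
    (hG : HasSDWith (universalLengthLeft i j LG LH))
    (hH : HasSDWith (universalLengthRight i j LG LH)) :
    HasSDWith (universalLength i j LG LH) := by
  obtain ⟨fG, fG_subexp, hfG⟩ := hG
  obtain ⟨fH, fH_subexp, hfH⟩ := hH
  have factor : SubexpBounded fun n ↦ 2 * (n : ℝ) + 1 :=
    .add (.mul (.const 2) (by simpa using SubexpBounded.natCast_pow 1)) (.const 1)
  refine hasSDWith_iff.2 ⟨fun n ↦ (2 * n + 1) ^ 2 * (fG (2 * n + 0) + fH (2 * n + 0)),
    (factor.pow 2).mul ((fG_subexp.subexpBounded.comp_affine 2 0).add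
      (fH_subexp.subexpBounded.comp_affine 2 0)), ?_⟩
  refine (hasDecay_universalLength hi hj hLG hLH hpos hfG hfH).mono fun n ↦ ?_
  gcongr
  exact max_le_add_of_nonneg (fG_subexp.1 _) (fH_subexp.1 _)

theorem hasRD_amalgam (hi : Function.Injective i) (hj : Function.Injective j)
    (hLG : IsLength LG) (hLH : IsLength LH) (hG : HasRDWith (universalLengthLeft i j LG LH))
    (hH : HasRDWith (universalLengthRight i j LG LH)) : HasRD (Amalgam i j) := by
  obtain ⟨LH', hLH', le, hpos⟩ := hLH.exists_ge_one_le_of_notMem j.range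
  exact ⟨_, isLength_universalLength hLG hLH', hasRDWith_universalLength hi hj hLG hLH' hpos
    (hG.mono fun _ ↦ universalLength_mono (fun _ ↦ le_rfl) le _)
    (hH.mono fun _ ↦ universalLength_mono (fun _ ↦ le_rfl) le _)⟩

theorem hasSD_amalgam (hi : Function.Injective i) (hj : Function.Injective j)
    (hLG : IsLength LG) (hLH : IsLength LH) (hG : HasSDWith (universalLengthLeft i j LG LH))
    (hH : HasSDWith (universalLengthRight i j LG LH)) : HasSD (Amalgam i j) := by
  obtain ⟨LH', hLH', le, hpos⟩ := hLH.exists_ge_one_le_of_notMem j.range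
  exact ⟨_, isLength_universalLength hLG hLH', hasSDWith_universalLength hi hj hLG hLH' hpos
    (hG.mono fun _ ↦ universalLength_mono (fun _ ↦ le_rfl) le _)
    (hH.mono fun _ ↦ universalLength_mono (fun _ ↦ le_rfl) le _)⟩

end Amalgam

end GroupDecay

theorem mainTheorem2_general {G H : Type u} {A : Type v} [Group G] [Group H] [Group A]
    (i : A →* G) (j : A →* H) (hi : Function.Injective i) (hj : Function.Injective j)
    (LG : G → ℕ) (LH : H → ℕ) (hLG : IsLength LG) (hLH : IsLength LH) :
    IsLength (universalLength i j LG LH) ∧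
    ((∀ y, y ∉ j.range → 1 ≤ LH y) →
      ∀ (f : ℕ → ℝ) (g : ℕ → ℕ), Monotone g → HasDecay LG f → HasDecay LH f →
      Distorted (fun n ↦ (g n : ℝ)) (universalLengthLeft i j LG LH) LG →
      Distorted (fun n ↦ (g n : ℝ)) (universalLengthRight i j LG LH) LH →
        HasDecay (universalLength i j LG LH) (tilde (f ∘ g)) ∧
        ((∀ n, n ≤ g n) →
          HasDecay (fun k ↦ 2 * universalLength i j LG LH k) (tilde f ∘ g)) ∧
        ((∀ n, n ≤ g n) → (∀ n, g (2 * n) ≤ 2 * g n) →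
          HasDecay (universalLength i j LG LH) (tilde f ∘ g))) ∧
    (HasRDWith LG → HasRDWith LH →
      PolynomiallyDistorted (universalLengthLeft i j LG LH) LG →
      PolynomiallyDistorted (universalLengthRight i j LG LH) LH →
        HasRD (Amalgam i j) ∧
        ((∀ y, y ∉ j.range → 1 ≤ LH y) → HasRDWith (universalLength i j LG LH))) ∧
    (HasRDWith LG → HasRDWith LH →
      SubexponentiallyDistorted (universalLengthLeft i j LG LH) LG →
      SubexponentiallyDistorted (universalLengthRight i j LG LH) LH →
        HasSD (Amalgam i j) ∧
        ((∀ y, y ∉ j.range → 1 ≤ LH y) → HasSDWith (universalLength i j LG LH))) ∧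
    (HasSDWith LG → HasSDWith LH →
      LinearlyDistorted (universalLengthLeft i j LG LH) LG →
      LinearlyDistorted (universalLengthRight i j LG LH) LH →
        HasSD (Amalgam i j) ∧
        ((∀ y, y ∉ j.range → 1 ≤ LH y) → HasSDWith (universalLength i j LG LH))) := by
  have hasRD (hG) (hH) := And.intro (hasRD_amalgam hi hj hLG hLH hG hH)
    fun hpos ↦ hasRDWith_universalLength hi hj hLG hLH hpos hG hH
  have hasSD (hG) (hH) := And.intro (hasSD_amalgam hi hj hLG hLH hG hH)
    fun hpos ↦ hasSDWith_universalLength hi hj hLG hLH hpos hG hH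
  refine ⟨isLength_universalLength hLG hLH, fun hpos f g hg hfG hfH hG hH ↦ ?_,
    fun hfG hfH hG hH ↦ hasRD (hfG.of_polynomiallyDistorted hG) (hfH.of_polynomiallyDistorted hH),
    fun hfG hfH hG hH ↦ hasSD (hfG.hasSDWith_of_subexponentiallyDistorted hG)
      (hfH.hasSDWith_of_subexponentiallyDistorted hH),
    fun hfG hfH hG hH ↦ hasSD (hfG.of_linearlyDistorted hG) (hfH.of_linearlyDistorted hH)⟩
  have decayOn {n m R : ℕ} :=
    decayOn_universalLength_of_distorted hi hj hLG hLH hpos hg hfG hfH hG hH (n := n) (m := m)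
      (R := R)
  refine ⟨fun n ↦ decayOn le_rfl le_rfl, fun le_g n ↦ ?_,
    fun le_g g_double n ↦ decayOn (le_g n) (g_double n)⟩
  have half_ball : DecayOn {k | universalLength i j LG LH k ≤ n / 2} (tilde f (g n)) :=
    decayOn ((Nat.div_le_self n 2).trans (le_g n))
      ((hg (Nat.mul_div_le n 2)).trans (Nat.le_mul_of_pos_left _ two_pos))
  exact half_ball.mono (fun k hk ↦ (Nat.le_div_iff_mul_le two_pos).2 (by rwa [mul_comm])) le_rfl

theorem mainTheorem2 {G H : Type u} {A : Type v} [Group G] [Group H] [Group A]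
    (i : A →* G) (j : A →* H) (hi : Function.Injective i) (hj : Function.Injective j)
    (LG : G → ℕ) (LH : H → ℕ) (hLG : IsLength LG) (hLH : IsLength LH) :
    IsLength (universalLength i j LG LH) ∧
    (PositiveOffAmalgam i j LG LH →
      ∀ (f : ℕ → ℝ) (g : ℕ → ℕ), Monotone g → HasDecay LG f → HasDecay LH f →
      Distorted (fun n => (g n : ℝ)) (universalLengthLeft i j LG LH) LG →
      Distorted (fun n => (g n : ℝ)) (universalLengthRight i j LG LH) LH →
        HasDecay (universalLength i j LG LH) (tilde (f ∘ g)) ∧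
        ((∀ n, n ≤ g n) →
          HasDecay (fun k => 2 * universalLength i j LG LH k) (tilde f ∘ g)) ∧
        ((∀ n, n ≤ g n) → (∀ n, g (2 * n) ≤ 2 * g n) →
          HasDecay (universalLength i j LG LH) (tilde f ∘ g))) ∧
    (HasRDWith LG → HasRDWith LH →
      PolynomiallyDistorted (universalLengthLeft i j LG LH) LG →
      PolynomiallyDistorted (universalLengthRight i j LG LH) LH →
        HasRD (Amalgam i j) ∧
        (PositiveOffAmalgam i j LG LH → HasRDWith (universalLength i j LG LH))) ∧
    (HasRDWith LG → HasRDWith LH →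
      SubexponentiallyDistorted (universalLengthLeft i j LG LH) LG →
      SubexponentiallyDistorted (universalLengthRight i j LG LH) LH →
        HasSD (Amalgam i j) ∧
        (PositiveOffAmalgam i j LG LH → HasSDWith (universalLength i j LG LH))) ∧
    (HasSDWith LG → HasSDWith LH →
      LinearlyDistorted (universalLengthLeft i j LG LH) LG →
      LinearlyDistorted (universalLengthRight i j LG LH) LH →
        HasSD (Amalgam i j) ∧
        (PositiveOffAmalgam i j LG LH → HasSDWith (universalLength i j LG LH))) := by
  refine (mainTheorem2_general i j hi hj LG LH hLG hLH).imp_right ?_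
  gcongr <;> exact And.right
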